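/- **Setting.** All spaces are real. Let $X\subset H\subset X^*$ be an evolution triple: $X$ is a reflexive Banach space, $H$ is a Hilbert space, the inclusion $X\subset H$ is continuous, $H$ is identified with its dual (so $h\in H$ acts on $X$ by $x\mapsto\langle h,x\rangle_H$), and each space is dense in the next one. Let $H_1,H_2$ be Hilbert spaces, $A:D(A)\subset X\to X^*$ a linear operator and $(b_1,b_2):D(b_1,b_2)\subset X\to H_1\times H_2$ a linear operator. Put $S=D(A)\cap D(b_1,b_2)$. Assume that $A$ is skew-adjoint modulo $(b_1,b_2)$, i.e. 1. $S$ is dense in $X$; 2. $\operatorname{Ker}(b_1,b_2)\cap D(A)$ is dense in $X$; 3. $(b_1,b_2)(S)$ is dense in $H_1\times H_2$; 4. $y\in X$ belongs to $S$ if and only if $\sup\{\langle y,Ax\rangle-\tfrac12(\|b_1x\|_{H_1}^2+\|b_2x\|_{H_2}^2):\ x\in S,\ \|x\|_X<1\}<\infty$; 5. $\langle y,Ax\rangle=-\langle Ay,x\rangle+\langle b_1x,b_1y\rangle_{H_1}-\langle b_2x,b_2y\rangle_{H_2}$ for all $x,y\in S$. For $\varphi:X\to\mathbb R$ let $\partial\varphi(x)\subset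 X^*$ be its subdifferential and $\varphi^*(p)=\sup_{x\in X}(\langle x,p\rangle-\varphi(x))$, $p\in X^*$, its Legendre conjugate. For $T>0$ let $A^2_H=A^2_H([0,T])$ be the space of absolutely continuous $u:[0,T]\to H$ with $\dot u\in L^2([0,T];H)$. **Proposition 5.2.** Let $\varphi:X\to\mathbb R$ be convex, lower semicontinuous, bounded on bounded subsets of $X$, and coercive on $X$ ($\varphi(x)\to+\infty$ as $\|x\|_X\to\infty$). Assume that $\varphi$ is uniformly convex on $H$ (for some $\varepsilon>0$ the function $x\mapsto\varphi(x)-\frac{\varepsilon}{2}\|x\|_H^2$ is convex on $X$) and that $\partial\varphi(0)\cap H\neq\emptyset$. Let $\omega\in\mathbb R$ and $T>0$. Then there is $v\in A^2_H$, with $v(t)\in S$ for a.e. $t\in[0,T]$, that solves $$-\dot v(t)+Av(t)\in\partial\varphi(v(t))+\omega v(t)\ \text{ for a.e. }t\in[0,T],\qquad b_1(v(t))=0\ \text{ for a.e. }t\in[0,T],\qquad v(0)=0.$$ It is obtained by minimizing over $u\in A^2_H$ the functional $$I(u)=\int_0^T\Big( e^{2\omega t}\big\{\varphi(e^{-\omega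 t}u(t))+\varphi^*\big(e^{-\omega t}(Au(t)-\dot u(t))\big)\big\}+\tfrac12\big(\|b_1(u(t))\|_{H_1}^2+\|b_2(u(t))\|_{H_2}^2\big)\Big)dt+\tfrac12\|u(0)\|_H^2+\tfrac12\|u(T)\|_H^2,$$ where the integrand is $+\infty$ whenever $u(t)\notin S$. That is, $\inf_{u\in A^2_H}I(u)=0$, and this minimum is attained at a path $y\in A^2_H$ such that $v(t)=e^{-\omega t}y(t)$ is a solution of the problem above. -/

import Mathlib

open MeasureTheory Filter Topology

noncomputable section

namespace ASD

/-! Throughout, `X` is a real Banach space, `StrongDual ℝ X` is its dual `X*`, and the pairing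
`⟨x, p⟩` of `x : X` with `p : X*` is `p x`. -/

section Convex

variable {X : Type*} [NormedAddCommGroup X] [NormedSpace ℝ X]

/-- Reflexivity: the canonical isometry of `X` into its bidual is onto. -/
def IsReflexive (X : Type*) [NormedAddCommGroup X] [NormedSpace ℝ X] : Prop :=
  Function.Surjective (NormedSpace.inclusionInDoubleDual ℝ X)

/-- The subdifferential `∂φ(x) ⊆ X*` of a finite function `φ` on `X`. -/
def subdifferential (φ : X → ℝ) (x : X) : Set (StrongDual ℝ X) :=
  {p | ∀ y, φ x + p (y - x) ≤ φ y}

/-- The Legendre-Fenchel conjugate `φ*(p) = sup_x (⟨x, p⟩ - φ(x))`, with values in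
`ℝ ∪ {+∞}`. -/
def conjugate (φ : X → ℝ) (p : StrongDual ℝ X) : EReal :=
  ⨆ x : X, ((p x - φ x : ℝ) : EReal)

end Convex

section SkewAdjoint

variable {X H₁ H₂ : Type*} [NormedAddCommGroup X] [NormedSpace ℝ X]
  [NormedAddCommGroup H₁] [InnerProductSpace ℝ H₁]
  [NormedAddCommGroup H₂] [InnerProductSpace ℝ H₂]

/-- The squared boundary norm `‖b₁(x)‖² + ‖b₂(x)‖²`, where `b = (b₁, b₂)` is defined on
`D(b₁, b₂) = b.domain`. -/
def bdrySq (b : X →ₗ.[ℝ] (H₁ × H₂)) (x : b.domain) : ℝ :=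
  ‖(b x).1‖ ^ 2 + ‖(b x).2‖ ^ 2

/-- The operator `A : D(A) ⊆ X → X*` is skew-adjoint modulo the boundary operators
`(b₁, b₂) : D(b₁, b₂) ⊆ X → H₁ × H₂`. Here `S = D(A) ∩ D(b₁, b₂)`. -/
structure SkewAdjointModulo (A : X →ₗ.[ℝ] StrongDual ℝ X) (b : X →ₗ.[ℝ] (H₁ × H₂)) :
    Prop where
  /-- `S` is dense in `X`. -/
  dense_domain : Dense ((A.domain ⊓ b.domain : Submodule ℝ X) : Set X)
  /-- `Ker (b₁, b₂) ∩ D(A)` is dense in `X`. -/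
  dense_ker : Dense {x : X | x ∈ A.domain ∧ ∃ hb : x ∈ b.domain, b ⟨x, hb⟩ = 0}
  /-- The image of `S` under `(b₁, b₂)` is dense in `H₁ × H₂`. -/
  dense_image : Dense {h : H₁ × H₂ | ∃ x : X, x ∈ A.domain ∧ ∃ hb : x ∈ b.domain, b ⟨x, hb⟩ = h}
  /-- `y ∈ S` if and only if
  `sup {⟨y, A x⟩ - (‖b₁ x‖² + ‖b₂ x‖²) / 2 ; x ∈ S, ‖x‖ < 1} < ∞`. -/
  mem_iff : ∀ y : X, (y ∈ A.domain ∧ y ∈ b.domain) ↔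
    BddAbove {r : ℝ | ∃ (x : X) (hA : x ∈ A.domain) (hb : x ∈ b.domain), ‖x‖ < 1 ∧
      r = A ⟨x, hA⟩ y - (1 / 2) * bdrySq b ⟨x, hb⟩}
  /-- `⟨y, A x⟩ = -⟨A y, x⟩ + ⟨b₁ x, b₁ y⟩ - ⟨b₂ x, b₂ y⟩` for all `x, y ∈ S`. -/
  green : ∀ (x y : X) (hxA : x ∈ A.domain) (hxb : x ∈ b.domain)
    (hyA : y ∈ A.domain) (hyb : y ∈ b.domain),
    A ⟨x, hxA⟩ y = -(A ⟨y, hyA⟩ x)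
      + inner ℝ (b ⟨x, hxb⟩).1 (b ⟨y, hyb⟩).1 - inner ℝ (b ⟨x, hxb⟩).2 (b ⟨y, hyb⟩).2

end SkewAdjoint

section Triple

variable {X H : Type*} [NormedAddCommGroup X] [NormedSpace ℝ X]
  [NormedAddCommGroup H] [InnerProductSpace ℝ H]

/-- The map `H → X*` dual to an embedding `j : X → H` (with `H` identified with its dual):
`h ↦ (x ↦ ⟨h, j x⟩_H)`. -/
def toDualX (j : X →L[ℝ] H) (h : H) : StrongDual ℝ X := (innerSL ℝ h).comp j

/-- `X ⊆ H ⊆ X*` is an evolution triple: `X` is a reflexive Banach space, `H` is a Hilbert space,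
`j : X → H` is the continuous inclusion, and each space is dense in the next one. -/
structure IsEvolutionTriple [CompleteSpace X] [CompleteSpace H] (j : X →L[ℝ] H) : Prop where
  reflexive : IsReflexive X
  injective : Function.Injective j
  dense_H : DenseRange j
  dense_dual : DenseRange (toDualX j)

end Triple

section Paths

variable {H : Type*} [NormedAddCommGroup H] [InnerProductSpace ℝ H]

/-- The path space `A²_H([0,T])` of absolutely continuous arcs `u : [0,T] → H` with
`u̇ ∈ L²([0,T]; H)`. Paths are represented by functions on `ℝ` of which only the values on `[0,T]`
matter; `u̇ = deriv u`, which exists at almost every point of `[0,T]`. -/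
structure MemA2 (T : ℝ) (u : ℝ → H) : Prop where
  absCont : AbsolutelyContinuousOnInterval u 0 T
  ae_diff : ∀ᵐ t ∂(volume.restrict (Set.Icc 0 T)), DifferentiableAt ℝ u t
  memLp_deriv : MemLp (deriv u) 2 (volume.restrict (Set.Icc 0 T))

end Paths

/-- The integral of an extended-real valued function: the integral of its positive part minus the
integral of its negative part. -/
def erealIntegral {α : Type*} [MeasurableSpace α] (μ : Measure α) (f : α → EReal) : EReal :=
  ((∫⁻ a, (f a).toENNReal ∂μ : ENNReal) : EReal) - ((∫⁻ a, (-(f a)).toENNReal ∂μ : ENNReal) : EReal)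

section Functional

variable {X H H₁ H₂ : Type*} [NormedAddCommGroup X] [NormedSpace ℝ X]
  [NormedAddCommGroup H] [InnerProductSpace ℝ H]
  [NormedAddCommGroup H₁] [InnerProductSpace ℝ H₁]
  [NormedAddCommGroup H₂] [InnerProductSpace ℝ H₂]

/-- The integrand at time `t`, position `h` and velocity `p`. If `h = j x` with
`x ∈ D(A) ∩ D(b₁, b₂)`, it equals
`e^{2ωt} (φ(e^{-ωt} x) + φ*(e^{-ωt} (A x - p))) + (‖b₁ x‖² + ‖b₂ x‖²) / 2`;
otherwise it is `+∞`. For injective `j` there is at most one such `x`, so the infimum only selects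
this value, or is the infimum `+∞` of the empty set. -/
def runningCost (j : X →L[ℝ] H) (A : X →ₗ.[ℝ] StrongDual ℝ X) (b : X →ₗ.[ℝ] (H₁ × H₂))
    (φ : X → ℝ) (ω t : ℝ) (h p : H) : EReal :=
  ⨅ (x : X) (hA : x ∈ A.domain) (hb : x ∈ b.domain) (_ : j x = h),
    ((Real.exp (2 * ω * t) : ℝ) : EReal) *
        (((φ (Real.exp (-(ω * t)) • x) : ℝ) : EReal)
          + conjugate φ (Real.exp (-(ω * t)) • (A ⟨x, hA⟩ - toDualX j p)))
      + (((1 / 2) * bdrySq b ⟨x, hb⟩ : ℝ) : EReal)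

/-- The functional `I(u)`: the integral over `[0,T]` of the integrand along `(u, u̇)`, plus
`(‖u(0)‖² + ‖u(T)‖²) / 2`. -/
def actionFunctional (j : X →L[ℝ] H) (A : X →ₗ.[ℝ] StrongDual ℝ X) (b : X →ₗ.[ℝ] (H₁ × H₂))
    (φ : X → ℝ) (ω T : ℝ) (u : ℝ → H) : EReal :=
  erealIntegral (volume.restrict (Set.Icc 0 T))
      (fun t => runningCost j A b φ ω t (u t) (deriv u t))
    + (((1 / 2) * ‖u 0‖ ^ 2 + (1 / 2) * ‖u T‖ ^ 2 : ℝ) : EReal)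

/-- `v ∈ A²_H([0,T])` solves the initial value problem: for almost every `t ∈ [0,T]`, `v(t)` lies in
`D(A) ∩ D(b₁, b₂)`, `-v̇(t) + A v(t) - ω v(t) ∈ ∂φ(v(t))` in `X*` and `b₁(v(t)) = 0`; and
`v(0) = 0`. -/
structure IsSolution (j : X →L[ℝ] H) (A : X →ₗ.[ℝ] StrongDual ℝ X) (b : X →ₗ.[ℝ] (H₁ × H₂))
    (φ : X → ℝ) (ω T : ℝ) (v : ℝ → H) : Prop where
  memA2 : MemA2 T v
  equation : ∀ᵐ t ∂(volume.restrict (Set.Icc 0 T)),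
    ∃ (x : X) (hA : x ∈ A.domain) (hb : x ∈ b.domain), j x = v t ∧
      -(toDualX j (deriv v t)) + A ⟨x, hA⟩ - ω • toDualX j (v t) ∈ subdifferential φ x ∧
      (b ⟨x, hb⟩).1 = 0
  initial : v 0 = 0

end Functional

end ASD

end

/-! The problem is an evolution equation `v̇ + M v + ω v ∋ 0` in `H`, where `M` is the part of `∂φ -
A` in `H` with boundary condition `b₁ = 0`, that is, `boundaryGraph`. It is solved by monotone
operator theory. The solution is then shown to minimize the functional, so no direct minimization
over paths is needed.

`M` is monotone because `∂φ` is, and because `⟨A x, x⟩ = -‖b₂ x‖² / 2` when `b₁ x = 0`. Its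
resolvent is everywhere defined: solving `x + l M x ∋ f` amounts to `A y ∈ ∂ψ(y)`, `b₁ y = 0`, where
`ψ` is `φ` plus a quadratic term. This stationary inclusion is
`exists_mem_subdifferential_of_skewAdjoint`. There, Hahn-Banach gives a subgradient at the origin of
the value function of a perturbed self-dual problem; by reflexivity, one component of it is the
solution.

The Yosida regularizations of `M` then give approximate paths with uniform velocity bounds. The
paths converge uniformly, convex combinations of their velocities converge in `L²`, and Minty's
trick identifies the limit (`exists_evolution`).

For the functional, Fenchel's inequality and the Green formula bound the integrand below by `-⟨u,
u̇⟩`, whose integral combines with the endpoint terms to `‖u(0)‖²`. Hence `I ≥ 0`. For `u = e^{ωt}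
v` Fenchel's inequality is an equality and `b₁` vanishes, so `I(u) = ‖v(0)‖² = 0`. -/

/-! ### Separation of convex epigraphs. -/

/-- A convex, upward closed subset of `V × ℝ` which contains a piece of a hyperplane above a ball
around the origin and lies above the origin is minorized by a continuous linear functional. -/
theorem exists_linear_le_of_convex_epigraph {V : Type*} [NormedAddCommGroup V] [NormedSpace ℝ V]
    {E : Set (V × ℝ)} (hE : Convex ℝ E) (hup : ∀ v s s', (v, s) ∈ E → s ≤ s' → (v, s') ∈ E)
    {r c : ℝ} (hr : 0 < r) (hball : ∀ v, ‖v‖ < r → (v, c) ∈ E) (h0 : ∀ s, ((0 : V), s) ∈ E → 0 ≤ s) :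
    ∃ l : V →L[ℝ] ℝ, ∀ v s, (v, s) ∈ E → l v ≤ s := by
  have hsub : Metric.ball (0 : V) r ×ˢ Set.Ioi c ⊆ E := by
    rintro ⟨v, s⟩ ⟨hv, hs⟩
    exact hup v c s (hball v (by simpa using hv)) (le_of_lt hs)
  have hint : (interior E).Nonempty :=
    ⟨(0, c + 1), interior_maximal hsub (Metric.isOpen_ball.prod isOpen_Ioi)
      ⟨by simpa using hr, by simp⟩⟩
  have hnot : ((0 : V), (0 : ℝ)) ∉ interior E := by
    intro h
    have hc : Continuous fun s : ℝ => ((0 : V), s) := by fun_prop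
    have h1 : ∀ᶠ s in 𝓝 (0 : ℝ), ((0 : V), s) ∈ E :=
      (hc.tendsto 0).eventually (mem_interior_iff_mem_nhds.1 h)
    obtain ⟨ε, hε, h2⟩ := Metric.eventually_nhds_iff.1 h1
    have := h0 (-(ε / 2)) (h2 (by rw [Real.dist_eq, sub_zero, abs_neg, abs_of_pos] <;> linarith))
    linarith
  obtain ⟨f, hf0, hf⟩ := geometric_hahn_banach_of_nonempty_interior_point hE hnot hint
  have hsplit : ∀ v s, f (v, s) = f (v, 0) + s * f (0, 1) := by
    intro v s
    have : ((v, s) : V × ℝ) = (v, 0) + s • (0, 1) := by simp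
    rw [this, map_add, map_smul, smul_eq_mul]
  have hle : ∀ v s, (v, s) ∈ E → f (v, 0) + s * f (0, 1) ≤ 0 := by
    intro v s h
    have := hf _ h
    rw [hsplit, show ((0 : V), (0 : ℝ)) = 0 from rfl, map_zero] at this
    exact this
  have hα0 : f (0, 1) ≤ 0 := by
    by_contra! h
    have h1 := hle 0 (max c 1) (hup 0 c _ (hball 0 (by simpa using hr)) (le_max_left _ _))
    rw [show ((0 : V), (0 : ℝ)) = 0 from rfl, map_zero, zero_add] at h1
    have : 0 < max c 1 * f (0, 1) := mul_pos (lt_of_lt_of_le one_pos (le_max_right _ _)) h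
    linarith
  -- The hyperplane is not vertical: otherwise `f` would be nonpositive on a symmetric ball of `V ×
  -- {0}`, hence zero there and everywhere.
  have hα : f (0, 1) < 0 := by
    refine lt_of_le_of_ne hα0 fun h => hf0 ?_
    have hneg : ∀ v : V, ‖v‖ < r → f (v, 0) ≤ 0 := fun v hv => by
      have := hle v c (hball v hv)
      rwa [h, mul_zero, add_zero] at this
    have hz : ∀ v : V, ‖v‖ < r → f (v, 0) = 0 := fun v hv => by
      refine le_antisymm (hneg v hv) ?_
      have := hneg (-v) (by rwa [norm_neg])
      rw [show ((-v, 0) : V × ℝ) = -(v, 0) by simp, map_neg] at this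
      linarith
    ext v
    · obtain ⟨k, hk, hkv⟩ : ∃ k : ℝ, 0 < k ∧ ‖k • v‖ < r := by
        refine ⟨r / (2 * (‖v‖ + 1)), by positivity, ?_⟩
        rw [norm_smul, Real.norm_of_nonneg (by positivity), div_mul_eq_mul_div,
          div_lt_iff₀ (by positivity)]
        nlinarith [norm_nonneg v]
      have := hz _ hkv
      rw [show ((k • v, 0) : V × ℝ) = k • (v, 0) by simp, map_smul, smul_eq_mul] at this
      simpa [hk.ne'] using this
    · simpa using h
  refine ⟨(-f (0, 1))⁻¹ • f.comp (ContinuousLinearMap.inl ℝ V ℝ), fun v s h => ?_⟩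
  have h1 := hle v s h
  simp only [smul_apply, ContinuousLinearMap.comp_apply,
    ContinuousLinearMap.inl_apply, smul_eq_mul]
  rw [inv_mul_le_iff₀ (by linarith)]
  linarith

theorem norm_sq_convex_comb_le {V : Type*} [NormedAddCommGroup V] [NormedSpace ℝ V] (x y : V)
    {a c : ℝ} (ha : 0 ≤ a) (hc : 0 ≤ c) (hac : a + c = 1) :
    ‖a • x + c • y‖ ^ 2 ≤ a * ‖x‖ ^ 2 + c * ‖y‖ ^ 2 := by
  simpa using ((convexOn_norm (convex_univ : Convex ℝ (Set.univ : Set V))).pow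
    (fun _ _ => norm_nonneg _) 2).2 (Set.mem_univ x) (Set.mem_univ y) ha hc hac

/-! ### The stationary inclusion by self-duality. -/

section Stationary

variable {X : Type*} [NormedAddCommGroup X] [NormedSpace ℝ X]

/-- Apply the separation lemma to the epigraph of the increment `v ↦ ψ (y + v) - ψ y`, which is
bounded above near the origin. -/
theorem exists_mem_subdifferential {ψ : X → ℝ} (hψ : ConvexOn ℝ Set.univ ψ)
    (hbdd : ∀ R : ℝ, ∃ C : ℝ, ∀ x, ‖x‖ ≤ R → ψ x ≤ C) (y : X) :
    ∃ p, p ∈ ASD.subdifferential ψ y := by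
  obtain ⟨C, hC⟩ := hbdd (‖y‖ + 1)
  obtain ⟨l, hl⟩ := exists_linear_le_of_convex_epigraph
    (E := {w : X × ℝ | ψ (y + w.1) - ψ y ≤ w.2}) (r := 1) (c := C - ψ y)
    (by
      rintro ⟨v, s⟩ hv ⟨w, t⟩ hw a c ha hc hac
      simp only [Set.mem_ofPred_eq, Prod.smul_mk, Prod.mk_add_mk, smul_eq_mul] at hv hw ⊢
      have h1 := hψ.2 (Set.mem_univ (y + v)) (Set.mem_univ (y + w)) ha hc hac
      have h2 : a • (y + v) + c • (y + w) = y + (a • v + c • w) := by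
        rw [smul_add, smul_add, add_add_add_comm, ← add_smul, hac, one_smul]
      rw [h2, smul_eq_mul, smul_eq_mul] at h1
      have h3 : ψ y = a * ψ y + c * ψ y := by rw [← add_mul, hac, one_mul]
      nlinarith)
    (fun v s s' h hs => le_trans h hs) one_pos
    (fun v hv => by
      have := hC (y + v) ((norm_add_le _ _).trans (by linarith))
      simp only [Set.mem_ofPred_eq]
      linarith)
    (fun s h => by simpa using h)
  refine ⟨l, fun z => ?_⟩
  have := hl (z - y) (ψ z - ψ y) (by simp)
  linarith

/-- The inclusion `A y ∈ ∂ψ(y)`, `β₁ y = 0`, for an operator that is skew-adjoint modulo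
`(β₁, β₂)`, by the self-duality of `ψ(x) + ψ*(A x) + (‖β₁ x‖² + ‖β₂ x‖²) / 2`. -/
theorem exists_mem_subdifferential_of_skewAdjoint
    {H₁ H₂ : Type*} [NormedAddCommGroup H₁] [InnerProductSpace ℝ H₁]
    [NormedAddCommGroup H₂] [InnerProductSpace ℝ H₂]
    (hX : ASD.IsReflexive X) {S : Submodule ℝ X} (L : S →ₗ[ℝ] StrongDual ℝ X)
    (β₁ : S →ₗ[ℝ] H₁) (β₂ : S →ₗ[ℝ] H₂)
    (hker : Dense {x : X | ∃ s : S, (s : X) = x ∧ β₁ s = 0 ∧ β₂ s = 0})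
    (himg : Dense (Set.range fun s : S => (β₁ s, β₂ s)))
    (hmem : ∀ y : X, BddAbove {r : ℝ | ∃ s : S, ‖(s : X)‖ < 1 ∧
      r = L s y - (1 / 2) * (‖β₁ s‖ ^ 2 + ‖β₂ s‖ ^ 2)} → y ∈ S)
    (green : ∀ s t : S, L s t = -(L t s) + inner ℝ (β₁ s) (β₁ t) - inner ℝ (β₂ s) (β₂ t))
    {ψ : X → ℝ} (hψ : ConvexOn ℝ Set.univ ψ)
    (hbdd : ∀ R : ℝ, ∃ C : ℝ, ∀ x, ‖x‖ ≤ R → ψ x ≤ C)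
    (hcoer : ∃ δ C : ℝ, 0 < δ ∧ ∀ z, δ * ‖z‖ - C ≤ ψ z) :
    ∃ y : S, β₁ y = 0 ∧ L y ∈ ASD.subdifferential ψ y := by
  obtain ⟨δ, C, hδ, hcoer⟩ := hcoer
  obtain ⟨C₁, hC₁⟩ := hbdd δ
  have hself : ∀ s : S, L s s = (1 / 2) * (‖β₁ s‖ ^ 2 - ‖β₂ s‖ ^ 2) := fun s => by
    have := green s s
    rw [real_inner_self_eq_norm_sq, real_inner_self_eq_norm_sq] at this
    linarith
  have hconj : ∀ r : StrongDual ℝ X, ‖r‖ ≤ δ → ∀ z, r z - ψ z ≤ C := fun r hr z => by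
    have h1 : r z ≤ ‖r‖ * ‖z‖ := (le_abs_self _).trans (r.le_opNorm z)
    have h2 : ‖r‖ * ‖z‖ ≤ δ * ‖z‖ := by gcongr
    linarith [hcoer z]
  -- The set is the epigraph of the value function `W(q, r) = inf_s ψ(q + s) + ψ*(r + L s) + (‖β₁
  -- s‖² + ‖β₂ s‖²) / 2`, with `c` standing for an upper bound of the conjugate. Taking `s = 0`
  -- bounds `W` near the origin; Fenchel's inequality and `hself` give `W(0, 0) ≥ inf ‖β₁ s‖² ≥ 0`.
  obtain ⟨l, hl⟩ := exists_linear_le_of_convex_epigraph (V := X × StrongDual ℝ X)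
    (E := {w | ∃ (s : S) (c : ℝ), (∀ z, (w.1.2 + L s) z - ψ z ≤ c) ∧
      ψ (w.1.1 + s) + c + (1 / 2) * (‖β₁ s‖ ^ 2 + ‖β₂ s‖ ^ 2) ≤ w.2}) (r := δ) (c := C₁ + C)
    (by
      rintro ⟨⟨q, r⟩, a⟩ ⟨s, c, h1, h2⟩ ⟨⟨q', r'⟩, a'⟩ ⟨s', c', h1', h2'⟩ k k' hk hk' hkk
      refine ⟨k • s + k' • s', k * c + k' * c', fun z => ?_, ?_⟩
      · have e1 := mul_le_mul_of_nonneg_left (h1 z) hk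
        have e2 := mul_le_mul_of_nonneg_left (h1' z) hk'
        have e3 : ψ z = k * ψ z + k' * ψ z := by rw [← add_mul, hkk, one_mul]
        simp only [Prod.smul_mk, Prod.mk_add_mk, map_add, map_smul,
          add_apply, smul_apply, smul_eq_mul] at e1 e2 ⊢
        rw [e3]
        linarith
      · simp only [Prod.smul_mk, Prod.mk_add_mk, map_add, map_smul, smul_eq_mul,
          Submodule.coe_add, Submodule.coe_smul] at h2 h2' ⊢
        have e1 := hψ.2 (Set.mem_univ (q + s)) (Set.mem_univ (q' + s')) hk hk' hkk
        rw [show k • (q + (s : X)) + k' • (q' + (s' : X))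
          = k • q + k' • q' + (k • (s : X) + k' • (s' : X)) by module] at e1
        have e2 := norm_sq_convex_comb_le (β₁ s) (β₁ s') hk hk' hkk
        have e3 := norm_sq_convex_comb_le (β₂ s) (β₂ s') hk hk' hkk
        have e4 := mul_le_mul_of_nonneg_left h2 hk
        have e5 := mul_le_mul_of_nonneg_left h2' hk'
        simp only [smul_eq_mul] at e1
        linarith)
    (fun v a a' ⟨s, c, h1, h2⟩ ha => ⟨s, c, h1, h2.trans ha⟩) hδ
    (fun v hv => by
      refine ⟨0, C, fun z => ?_, ?_⟩
      · simpa using hconj v.2 ((norm_snd_le v).trans hv.le) z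
      · have := hC₁ v.1 ((norm_fst_le v).trans hv.le)
        simpa using this)
    (fun a ⟨s, c, h1, h2⟩ => by
      have h3 := h1 s
      simp only [Prod.fst_zero, Prod.snd_zero, zero_add] at h2 h3
      rw [hself] at h3
      nlinarith [sq_nonneg ‖β₁ s‖])
  -- Reflexivity turns the second component of the subgradient `l = (p, y)` into a point of `X`.
  obtain ⟨y, hy⟩ := hX (l.comp (ContinuousLinearMap.inr ℝ X (StrongDual ℝ X)))
  set p : StrongDual ℝ X := l.comp (ContinuousLinearMap.inl ℝ X (StrongDual ℝ X)) with hp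
  have key : ∀ (s : S) (q : X) (r : StrongDual ℝ X) (c : ℝ), (∀ z, r z - ψ z ≤ c) →
      p q - p s + r y - L s y ≤ ψ q + c + (1 / 2) * (‖β₁ s‖ ^ 2 + ‖β₂ s‖ ^ 2) := by
    intro s q r c hc
    have h1 := hl (q - s, r - L s) _ ⟨s, c, by simpa using hc,
      le_refl (ψ (q - s + s) + c + (1 / 2) * (‖β₁ s‖ ^ 2 + ‖β₂ s‖ ^ 2))⟩
    have h2 : l (q - s, r - L s) = p q - p s + r y - L s y := by
      have h3 : (r - L s) y = l (0, r - L s) := by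
        rw [← NormedSpace.dual_def ℝ X y, hy]; rfl
      have h4 : p q - p s = l (q - s, 0) := by rw [← map_sub]; rfl
      rw [h4, add_sub_assoc, ← sub_apply, h3, ← map_add]
      simp
    rw [h2] at h1
    simpa using h1
  -- With `q = r = 0` and `-s` in place of `s`, `key` is the bound that characterizes membership in
  -- `S`.
  have hyS : y ∈ S := by
    refine hmem y ⟨ψ 0 + C + ‖p‖, ?_⟩
    rintro _ ⟨s, hs, rfl⟩
    have h1 := key (-s) 0 0 C (hconj 0 (by simpa using hδ.le))
    simp only [map_neg, map_zero, norm_neg, neg_apply,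
      zero_apply, Submodule.coe_neg] at h1
    have h2 : -(p s) ≤ ‖p‖ := by
      refine (neg_le_abs _).trans ((p.le_opNorm _).trans ?_)
      exact mul_le_of_le_one_right (norm_nonneg _) hs.le
    linarith
  lift y to S using hyS
  have hpy : p = L y := by
    refine DFunLike.coe_injective (Continuous.ext_on hker p.continuous (L y).continuous ?_)
    rintro _ ⟨s, rfl, hs1, hs2⟩
    -- On the kernel of the boundary operators the quadratic term disappears, so a linear function
    -- of `k` is bounded and must vanish.
    have h1 : ∀ k : ℝ, -(k * (p s + L s y)) ≤ ψ 0 + C := fun k => by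
      have h1 := key (k • s) 0 0 C (hconj 0 (by simpa using hδ.le))
      simp only [map_smul, map_zero, hs1, hs2, smul_zero, smul_apply,
        zero_apply, Submodule.coe_smul, smul_eq_mul, norm_zero] at h1
      linarith
    have h2 : p s + L s y = 0 := by
      by_contra h
      have := h1 (-(ψ 0 + C + 1) / (p s + L s y))
      rw [div_mul_cancel₀ _ h] at this
      linarith
    have h3 := green s y
    rw [hs1, hs2, inner_zero_left, inner_zero_left] at h3
    linarith
  -- For this `r` the conjugate is `r y - ψ y`, so `r` cancels in `key` and only the boundary values
  -- of `s` remain. These are dense, hence may be replaced by any `h`.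
  obtain ⟨r, hr⟩ := exists_mem_subdifferential hψ hbdd (y : X)
  have key2 : ∀ (q : X) (h : H₁ × H₂), L y q + ψ y ≤ ψ q
      + (1 / 2) * (‖h.1‖ ^ 2 + ‖h.2‖ ^ 2) + inner ℝ h.1 (β₁ y) - inner ℝ h.2 (β₂ y) := by
    intro q
    refine himg.induction ?_ ?_
    · rintro _ ⟨s, rfl⟩
      have h1 := key s q r (r y - ψ y) (fun z => by
        have := hr z
        rw [map_sub] at this
        linarith)
      rw [hpy, green s y] at h1
      linarith
    · exact isClosed_le (by fun_prop) (by fun_prop)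
  have key3 : ∀ q : X, L y q + ψ y ≤ ψ q - (1 / 2) * (‖β₁ y‖ ^ 2 + ‖β₂ y‖ ^ 2) := fun q => by
    -- This choice minimizes the right-hand side over `h`; then `q = y` forces `β₁ y = 0`.
    have := key2 q (-β₁ y, β₂ y)
    simp only [norm_neg, inner_neg_left, real_inner_self_eq_norm_sq] at this
    linarith
  have hβ : ‖β₁ y‖ ^ 2 = 0 := by
    have := key3 y
    rw [hself] at this
    nlinarith [sq_nonneg ‖β₁ y‖]
  refine ⟨y, by simpa using hβ, fun z => ?_⟩
  have := key3 z
  rw [map_sub, hself]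
  linarith

end Stationary

/-! ### Lipschitz equations, convex combinations and Yosida regularization. -/

section Evolution

variable {H : Type*} [NormedAddCommGroup H]

/-- Global solvability of an autonomous differential equation with Lipschitz right-hand side. -/
theorem exists_hasDerivAt_of_lipschitzWith [NormedSpace ℝ H] [CompleteSpace H] {f : H → H}
    {K : NNReal} (hf : LipschitzWith K f) (x₀ : H) {T : ℝ} (hT : 0 ≤ T) :
    ∃ w : ℝ → H, w 0 = x₀ ∧ ∀ t ∈ Set.Icc 0 T, HasDerivAt w (f (w t)) t := by
  -- The unknown is rescaled by `e^{-Λt}`. The Picard map then has Lipschitz constant at most `K / Λ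
  -- ≤ 1/2` on all of `[0, T]`, so no gluing of local solutions is needed.
  obtain ⟨Λ, hΛ⟩ : ∃ Λ : ℝ, Λ = 2 * (K + 1) := ⟨_, rfl⟩
  have hΛ0 : 0 < Λ := by rw [hΛ]; positivity
  set ext : C(Set.Icc (0 : ℝ) T, H) → ℝ → H :=
    fun u s => Real.exp (Λ * s) • u (Set.projIcc 0 T hT s) with hext
  have hextc : ∀ u, Continuous (ext u) := fun u => by
    have : Continuous (Set.projIcc 0 T hT) := continuous_projIcc
    simp only [hext]
    fun_prop
  have hfc : ∀ u, Continuous fun s => f (ext u s) := fun u => hf.continuous.comp (hextc u)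
  set P : C(Set.Icc (0 : ℝ) T, H) → ℝ → H := fun u t => x₀ + ∫ s in (0 : ℝ)..t, f (ext u s) with hP
  have hPd : ∀ u t, HasDerivAt (P u) (f (ext u t)) t := fun u t =>
    ((hfc u).integral_hasStrictDerivAt 0 t).hasDerivAt.const_add x₀
  have hPc : ∀ u, Continuous (P u) := fun u =>
    continuous_iff_continuousAt.2 fun t => (hPd u t).continuousAt
  set Φ : C(Set.Icc (0 : ℝ) T, H) → C(Set.Icc (0 : ℝ) T, H) := fun u =>
    ⟨fun t => Real.exp (-(Λ * t)) • P u t, by have := hPc u; fun_prop⟩ with hΦ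
  have hcontr : ContractingWith (1 / 2) Φ := by
    refine ⟨by rw [← NNReal.coe_lt_coe]; norm_num, LipschitzWith.of_dist_le_mul fun u v => ?_⟩
    rw [ContinuousMap.dist_le (by positivity)]
    rintro ⟨t, ht0, htT⟩
    have h1 : ∀ s ∈ Set.Icc (0 : ℝ) t,
        ‖f (ext u s) - f (ext v s)‖ ≤ K * dist u v * Real.exp (Λ * s) := by
      intro s hs
      rw [← dist_eq_norm]
      refine (hf.dist_le_mul _ _).trans ?_
      simp only [hext]
      rw [dist_smul₀, Real.norm_of_nonneg (Real.exp_pos _).le, mul_assoc, mul_comm (dist u v)]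
      gcongr ?_ * (?_ * ?_)
      exact ContinuousMap.dist_apply_le_dist _
    have h2 : ‖∫ s in (0 : ℝ)..t, (f (ext u s) - f (ext v s))‖
        ≤ ∫ s in (0 : ℝ)..t, K * dist u v * Real.exp (Λ * s) :=
      intervalIntegral.norm_integral_le_of_norm_le ht0
        (Eventually.of_forall fun s hs => h1 s ⟨hs.1.le, hs.2⟩)
        (Continuous.intervalIntegrable (by fun_prop) _ _)
    have h3 : ∫ s in (0 : ℝ)..t, K * dist u v * Real.exp (Λ * s)
        = K * dist u v * ((Real.exp (Λ * t) - 1) / Λ) := by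
      rw [intervalIntegral.integral_const_mul, intervalIntegral.integral_comp_mul_left _ hΛ0.ne',
        integral_exp, mul_zero, Real.exp_zero, smul_eq_mul]
      ring
    have h4 : dist (Φ u ⟨t, ht0, htT⟩) (Φ v ⟨t, ht0, htT⟩)
        = Real.exp (-(Λ * t)) * ‖∫ s in (0 : ℝ)..t, (f (ext u s) - f (ext v s))‖ := by
      simp only [hΦ, hP, ContinuousMap.coe_mk]
      rw [dist_smul₀, Real.norm_of_nonneg (Real.exp_pos _).le, dist_add_left, dist_eq_norm,
        intervalIntegral.integral_sub ((hfc u).intervalIntegrable _ _)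
          ((hfc v).intervalIntegrable _ _)]
    rw [h4]
    calc _ ≤ Real.exp (-(Λ * t)) * (K * dist u v * ((Real.exp (Λ * t) - 1) / Λ)) := by
          rw [← h3]; gcongr
      _ ≤ Real.exp (-(Λ * t)) * (K * dist u v * (Real.exp (Λ * t) / Λ)) := by
          gcongr; linarith
      _ = (K / Λ) * dist u v := by
          rw [Real.exp_neg]
          field_simp [(Real.exp_pos (Λ * t)).ne']
      _ ≤ _ := by
          gcongr
          rw [div_le_iff₀ hΛ0]
          push_cast
          rw [hΛ]
          linarith [K.coe_nonneg]
  obtain ⟨u, hu⟩ : ∃ u, Φ u = u := ⟨_, hcontr.fixedPoint_isFixedPt⟩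
  refine ⟨P u, by simp [hP], fun t ht => ?_⟩
  have h1 : ext u t = P u t := by
    simp only [hext]
    rw [Set.projIcc_of_mem hT ht]
    conv_lhs => rw [← hu]
    simp [hΦ, smul_smul, ← Real.exp_add]
  rw [← h1]
  exact hPd u t

/-- A bounded sequence in a Hilbert space has strongly convergent convex combinations of its
tails. -/
theorem exists_tendsto_convexHull_tail [InnerProductSpace ℝ H] [CompleteSpace H] {x : ℕ → H}
    {C : ℝ} (hx : ∀ n, ‖x n‖ ≤ C) :
    ∃ (g : H) (y : ℕ → H), (∀ n, y n ∈ convexHull ℝ (x '' Set.Ici n)) ∧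
      Tendsto y atTop (𝓝 g) := by
  set K : ℕ → Set H := fun n => convexHull ℝ (x '' Set.Ici n) with hK
  have hKx : ∀ n, x n ∈ K n := fun n => subset_convexHull ℝ _ ⟨n, Set.mem_Ici.2 le_rfl, rfl⟩
  have hanti : ∀ {m n}, m ≤ n → K n ⊆ K m := fun h =>
    convexHull_mono (Set.image_mono (Set.Ici_subset_Ici.2 h))
  set d : ℕ → ℝ := fun n => sInf (norm '' K n) with hd
  have hbdd : ∀ n, BddBelow (norm '' K n) := fun n =>
    ⟨0, by rintro _ ⟨z, -, rfl⟩; exact norm_nonneg z⟩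
  have hdle : ∀ n z, z ∈ K n → d n ≤ ‖z‖ := fun n z hz => csInf_le (hbdd n) ⟨z, hz, rfl⟩
  have hd0 : ∀ n, 0 ≤ d n := fun n => Real.sInf_nonneg (by rintro _ ⟨z, -, rfl⟩; exact norm_nonneg z)
  have hdmono : Monotone d := fun m n h =>
    csInf_le_csInf (hbdd m) ⟨_, x n, hKx n, rfl⟩ (Set.image_mono (hanti h))
  have hdC : BddAbove (Set.range d) :=
    ⟨C, by rintro _ ⟨n, rfl⟩; exact (hdle n _ (hKx n)).trans (hx n)⟩
  have hdt := tendsto_atTop_ciSup hdmono hdC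
  set D : ℝ := ⨆ n, d n with hD
  have hε : Tendsto (fun n : ℕ => 1 / ((n : ℝ) + 1)) atTop (𝓝 0) :=
    tendsto_one_div_add_atTop_nhds_zero_nat
  have hex : ∀ n, ∃ y ∈ K n, ‖y‖ < d n + 1 / ((n : ℝ) + 1) := fun n => by
    obtain ⟨_, ⟨y, hy, rfl⟩, h⟩ := exists_lt_of_csInf_lt (s := norm '' K n) ⟨_, x n, hKx n, rfl⟩
      (show sInf (norm '' K n) < d n + 1 / ((n : ℝ) + 1) by
        have : 0 < 1 / ((n : ℝ) + 1) := by positivity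
        simp only [hd]; linarith)
    exact ⟨y, hy, h⟩
  choose y hyK hy using hex
  -- Midpoints of `y n` and `y m` stay in `K n`, so their norm is at least `d n`. As both norms are
  -- close to the limit `D`, the parallelogram law makes the difference small.
  have hcauchy : CauchySeq y := by
    refine cauchySeq_of_le_tendsto_0'
      (fun n => √(2 * (d n + 1 / ((n : ℝ) + 1)) ^ 2 + 2 * (D + 1 / ((n : ℝ) + 1)) ^ 2
        - 4 * d n ^ 2)) (fun n m hnm => ?_) ?_
    · rw [dist_eq_norm]
      refine Real.le_sqrt_of_sq_le ?_
      have h1 := parallelogram_law_with_norm ℝ (y n) (y m)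
      have h2 : d n ≤ ‖(1 / 2 : ℝ) • y n + (1 / 2 : ℝ) • y m‖ :=
        hdle n _ (convex_convexHull ℝ _ (hyK n) (hanti hnm (hyK m)) (by norm_num) (by norm_num)
          (by norm_num))
      rw [← smul_add, norm_smul, Real.norm_of_nonneg (by norm_num)] at h2
      have h3 : (2 * d n) ^ 2 ≤ ‖y n + y m‖ ^ 2 := by
        have := hd0 n
        gcongr
        linarith
      have h4 : ‖y n‖ ^ 2 ≤ (d n + 1 / ((n : ℝ) + 1)) ^ 2 := by
        gcongr; exact (hy n).le
      have h5 : ‖y m‖ ^ 2 ≤ (D + 1 / ((n : ℝ) + 1)) ^ 2 := by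
        gcongr
        refine (hy m).le.trans (add_le_add (le_ciSup hdC m) ?_)
        gcongr
      nlinarith
    · have : Tendsto (fun n => √(2 * (d n + 1 / ((n : ℝ) + 1)) ^ 2
          + 2 * (D + 1 / ((n : ℝ) + 1)) ^ 2 - 4 * d n ^ 2)) atTop
          (𝓝 √(2 * (D + 0) ^ 2 + 2 * (D + 0) ^ 2 - 4 * D ^ 2)) :=
        (((((hdt.add hε).pow 2).const_mul 2).add
          (((tendsto_const_nhds.add hε).pow 2).const_mul 2)).sub ((hdt.pow 2).const_mul 4)).sqrt
      convert this using 2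
      rw [show 2 * (D + 0) ^ 2 + 2 * (D + 0) ^ 2 - 4 * D ^ 2 = 0 by ring, Real.sqrt_zero]
  obtain ⟨g, hg⟩ := cauchySeq_tendsto_of_complete hcauchy
  exact ⟨g, y, hyK, hg⟩

variable [InnerProductSpace ℝ H]

/-- Growth of the distance of two curves under a one-sided bound on their velocities. -/
theorem exp_mul_norm_sub_sq_le {w₁ w₂ w₁' w₂' : ℝ → H} {ω S c : ℝ}
    (h₁ : ∀ t ∈ Set.Icc 0 S, HasDerivAt w₁ (w₁' t) t)
    (h₂ : ∀ t ∈ Set.Icc 0 S, HasDerivAt w₂ (w₂' t) t)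
    (hle : ∀ t ∈ Set.Icc 0 S, Real.exp (2 * ω * t) *
      (2 * (inner ℝ (w₁ t - w₂ t) (w₁' t - w₂' t) + ω * ‖w₁ t - w₂ t‖ ^ 2)) ≤ c)
    {t : ℝ} (ht : t ∈ Set.Icc 0 S) :
    Real.exp (2 * ω * t) * ‖w₁ t - w₂ t‖ ^ 2 ≤ ‖w₁ 0 - w₂ 0‖ ^ 2 + c * t := by
  have hd : ∀ s ∈ Set.Icc 0 S,
      HasDerivAt (fun r => Real.exp (2 * ω * r) * ‖w₁ r - w₂ r‖ ^ 2 - c * r)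
        (Real.exp (2 * ω * s) * (2 * (inner ℝ (w₁ s - w₂ s) (w₁' s - w₂' s)
          + ω * ‖w₁ s - w₂ s‖ ^ 2)) - c) s := by
    intro s hs
    have e1 : HasDerivAt (fun r => Real.exp (2 * ω * r)) (Real.exp (2 * ω * s) * (2 * ω)) s := by
      simpa using ((hasDerivAt_id s).const_mul (2 * ω)).exp
    have e2 := ((h₁ s hs).sub (h₂ s hs)).norm_sq
    have e3 := (e1.mul e2).sub ((hasDerivAt_id s).const_mul c)
    refine e3.congr_deriv ?_
    simp only [Pi.sub_apply]
    ring
  have hanti : AntitoneOn (fun r => Real.exp (2 * ω * r) * ‖w₁ r - w₂ r‖ ^ 2 - c * r)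
      (Set.Icc 0 S) := by
    refine antitoneOn_of_hasDerivWithinAt_nonpos (convex_Icc 0 S)
      (fun s hs => (hd s hs).continuousAt.continuousWithinAt)
      (fun s hs => (hd s (interior_subset hs)).hasDerivWithinAt) fun s hs => ?_
    linarith [hle s (interior_subset hs)]
  have := hanti ⟨le_rfl, ht.1.trans ht.2⟩ ht ht.1
  simp only [mul_zero, Real.exp_zero, one_mul, sub_zero] at this
  linarith

variable {G : Set (H × H)}

/-- The Yosida approximation `a` of a monotone graph with full resolvent, together with the
resolvent `z`. -/
theorem exists_yosida (hmono : ∀ p ∈ G, ∀ q ∈ G, 0 ≤ inner ℝ (p.1 - q.1) (p.2 - q.2))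
    {l : ℝ} (hl : 0 < l) (hres : ∀ f : H, ∃ p ∈ G, p.1 + l • p.2 = f) :
    ∃ z a : H → H, (∀ x, (z x, a x) ∈ G) ∧ (∀ x, z x + l • a x = x) ∧
      LipschitzWith (Real.toNNReal l⁻¹) a ∧
      (∀ x y, 0 ≤ inner ℝ (x - y) (a x - a y)) ∧ ∀ p ∈ G, ‖a p.1‖ ≤ ‖p.2‖ := by
  choose p hpG hp using hres
  -- Cocoercivity gives both the monotonicity and the Lipschitz constant `l⁻¹`.
  have key : ∀ x y, l * ‖(p x).2 - (p y).2‖ ^ 2 ≤ inner ℝ (x - y) ((p x).2 - (p y).2) := by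
    intro x y
    have h1 : x - y = ((p x).1 - (p y).1) + l • ((p x).2 - (p y).2) := by
      nth_rewrite 1 [← hp x, ← hp y]
      module
    rw [h1, inner_add_left, inner_smul_left, real_inner_self_eq_norm_sq]
    have := hmono _ (hpG x) _ (hpG y)
    simp only [conj_trivial]
    linarith
  refine ⟨fun x => (p x).1, fun x => (p x).2, hpG, hp, ?_, fun x y => ?_, fun q hq => ?_⟩
  · refine LipschitzWith.of_dist_le_mul fun x y => ?_
    rw [Real.coe_toNNReal _ (inv_pos.2 hl).le, dist_eq_norm, dist_eq_norm, le_inv_mul_iff₀ hl]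
    have h1 := (key x y).trans (real_inner_le_norm _ _)
    by_contra! h
    have h2 : 0 < ‖(p x).2 - (p y).2‖ := by
      by_contra! h'
      have : ‖(p x).2 - (p y).2‖ = 0 := le_antisymm h' (norm_nonneg _)
      rw [this, mul_zero] at h
      exact absurd h (not_lt.2 (norm_nonneg _))
    nlinarith
  · exact le_trans (by positivity) (key x y)
  · have h1 := hmono _ (hpG q.1) _ hq
    have h2 : (p q.1).1 - q.1 = -(l • (p q.1).2) := by
      nth_rewrite 2 [← hp q.1]
      abel
    rw [h2, inner_neg_left, inner_smul_left, inner_sub_right, real_inner_self_eq_norm_sq] at h1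
    have h3 := real_inner_le_norm (p q.1).2 q.2
    simp only [conj_trivial] at h1
    have h4 : ‖(p q.1).2‖ ^ 2 ≤ inner ℝ (p q.1).2 q.2 := by
      by_contra! h
      nlinarith
    by_contra! h
    have : 0 < ‖(p q.1).2‖ := lt_of_le_of_lt (norm_nonneg _) h
    nlinarith

/-- Solutions of the Yosida regularized evolution equations, with bounds that do not depend on the
regularization parameter. -/
theorem exists_yosida_path [CompleteSpace H]
    (hmono : ∀ p ∈ G, ∀ q ∈ G, 0 ≤ inner ℝ (p.1 - q.1) (p.2 - q.2))
    (hres : ∀ l : ℝ, 0 < l → ∀ f : H, ∃ p ∈ G, p.1 + l • p.2 = f)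
    {x₀ h₀ : H} (h0 : (x₀, h₀) ∈ G) (ω : ℝ) {T : ℝ} (hT : 0 < T) :
    ∃ C R : ℝ, ∀ l : ℝ, 0 < l → ∃ w z a : ℝ → H, w 0 = x₀ ∧
      ∀ t ∈ Set.Icc 0 T, HasDerivAt w (-(a t) - ω • w t) t ∧ ContinuousWithinAt a (Set.Icc 0 T) t ∧
        (z t, a t) ∈ G ∧ z t + l • a t = w t ∧ ‖a t‖ ≤ C ∧ ‖w t‖ ≤ R := by
  set B : ℝ := Real.exp (|ω| * T) * (‖h₀‖ + |ω| * ‖x₀‖) with hB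
  set R : ℝ := ‖x₀‖ + B * T with hR
  refine ⟨B + |ω| * R, R, fun l hl => ?_⟩
  obtain ⟨z, a, hG, hza, hlip, ham, ha0⟩ := exists_yosida hmono hl (hres l hl)
  have hlip' : LipschitzWith (Real.toNNReal l⁻¹ + ‖ω‖₊) fun x => -(a x) - ω • x :=
    hlip.neg.sub (lipschitzWith_smul ω)
  -- The interval is doubled so that time shifts by `s ≤ T` remain solutions on `[0, T]`.
  obtain ⟨w, hw0, hw⟩ := exists_hasDerivAt_of_lipschitzWith hlip' x₀ (T := 2 * T) (by linarith)
  have hwT : ∀ t ∈ Set.Icc 0 T, HasDerivAt w (-(a (w t)) - ω • w t) t := fun t ht =>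
    hw t ⟨ht.1, by linarith [ht.2]⟩
  have hder : ∀ t ∈ Set.Icc 0 T, ‖-(a (w t)) - ω • w t‖ ≤ B := by
    intro t ht
    -- Comparing the path with its own time shift and letting the shift tend to zero bounds the
    -- velocity by the initial one, which `ha0` controls by `‖h₀‖` uniformly in `l`.
    have hshift : ∀ s ∈ Set.Icc 0 T, ‖w (t + s) - w t‖ ≤ Real.exp (-(ω * t)) * ‖w s - w 0‖ := by
      intro s hs
      have h1 := exp_mul_norm_sub_sq_le (w₁ := fun r => w (r + s)) (w₂ := w) (ω := ω) (S := T)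
        (c := 0) (fun r hr => (hw (r + s) ⟨by linarith [hr.1, hs.1], by linarith [hr.2, hs.2]⟩).comp_add_const r s)
        hwT (fun r hr => by
          have h2 := ham (w (r + s)) (w r)
          have h3 : -(a (w (r + s))) - ω • w (r + s) - (-(a (w r)) - ω • w r)
              = -(a (w (r + s)) - a (w r)) - ω • (w (r + s) - w r) := by module
          rw [h3, inner_sub_right, inner_neg_right, inner_smul_right, real_inner_self_eq_norm_sq]
          have := Real.exp_pos (2 * ω * r)
          nlinarith) ht
      simp only [zero_mul, add_zero, zero_add] at h1
      rw [show 2 * ω * t = ω * t + ω * t by ring, Real.exp_add] at h1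
      rw [Real.exp_neg, le_inv_mul_iff₀ (Real.exp_pos _)]
      refine le_of_sq_le_sq ?_ (norm_nonneg _)
      calc _ = _ := by ring
        _ ≤ _ := h1
    have h1 : Tendsto (fun s : ℝ => ‖s⁻¹ • (w (t + s) - w t)‖) (𝓝[>] 0)
        (𝓝 ‖-(a (w t)) - ω • w t‖) := (hwT t ht).tendsto_slope_zero_right.norm
    have h2 : Tendsto (fun s : ℝ => Real.exp (-(ω * t)) * ‖s⁻¹ • (w (0 + s) - w 0)‖) (𝓝[>] 0)
        (𝓝 (Real.exp (-(ω * t)) * ‖-(a (w 0)) - ω • w 0‖)) :=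
      ((hwT 0 ⟨le_rfl, hT.le⟩).tendsto_slope_zero_right.norm).const_mul _
    have h3 := le_of_tendsto_of_tendsto h1 h2 (by
      filter_upwards [Ioc_mem_nhdsGT hT] with s hs
      rw [norm_smul, norm_smul, zero_add, mul_left_comm]
      gcongr
      exact hshift s ⟨hs.1.le, hs.2⟩)
    refine h3.trans ?_
    rw [hB, hw0]
    gcongr
    · calc -(ω * t) ≤ |ω * t| := neg_le_abs _
        _ = |ω| * t := by rw [abs_mul, abs_of_nonneg ht.1]
        _ ≤ |ω| * T := by gcongr; exact ht.2
    · refine (norm_sub_le _ _).trans ?_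
      rw [norm_neg, norm_smul, Real.norm_eq_abs]
      gcongr
      exact ha0 _ h0
  have hB0 : 0 ≤ B := by positivity
  have hwR : ∀ t ∈ Set.Icc 0 T, ‖w t‖ ≤ R := by
    intro t ht
    have h1 := (convex_Icc 0 T).norm_image_sub_le_of_norm_hasDerivWithin_le
      (fun s hs => (hwT s hs).hasDerivWithinAt) hder ⟨le_rfl, hT.le⟩ ht
    rw [sub_zero, Real.norm_of_nonneg ht.1, hw0] at h1
    calc ‖w t‖ = ‖x₀ + (w t - x₀)‖ := by rw [add_sub_cancel]
      _ ≤ ‖x₀‖ + ‖w t - x₀‖ := norm_add_le _ _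
      _ ≤ ‖x₀‖ + B * T := by
        gcongr
        refine h1.trans ?_
        gcongr
        exact ht.2
  refine ⟨w, fun t => z (w t), fun t => a (w t), hw0, fun t ht => ⟨hwT t ht, ?_, hG _, hza _, ?_,
    hwR t ht⟩⟩
  · exact hlip.continuous.continuousAt.comp_continuousWithinAt
      (hwT t ht).continuousAt.continuousWithinAt
  · calc ‖a (w t)‖ = ‖-(-(a (w t)) - ω • w t) - ω • w t‖ := by congr 1; module
      _ ≤ ‖-(-(a (w t)) - ω • w t)‖ + ‖ω • w t‖ := norm_sub_le _ _
      _ ≤ B + |ω| * R := by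
        rw [norm_neg, norm_smul, Real.norm_eq_abs]
        gcongr
        · exact hder t ht
        · exact hwR t ht

/-- Two solutions of Yosida regularized equations are close for small parameters. -/
theorem norm_sub_sq_le_of_yosida
    (hmono : ∀ p ∈ G, ∀ q ∈ G, 0 ≤ inner ℝ (p.1 - q.1) (p.2 - q.2)) {ω T C l m : ℝ}
    (hl : 0 < l) (hm : 0 < m) {w z a w' z' a' : ℝ → H} (h0 : w 0 = w' 0)
    (hw : ∀ t ∈ Set.Icc 0 T, HasDerivAt w (-(a t) - ω • w t) t ∧ (z t, a t) ∈ G ∧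
      z t + l • a t = w t ∧ ‖a t‖ ≤ C)
    (hw' : ∀ t ∈ Set.Icc 0 T, HasDerivAt w' (-(a' t) - ω • w' t) t ∧ (z' t, a' t) ∈ G ∧
      z' t + m • a' t = w' t ∧ ‖a' t‖ ≤ C) {t : ℝ} (ht : t ∈ Set.Icc 0 T) :
    ‖w t - w' t‖ ^ 2 ≤ Real.exp (2 * |ω| * T) * Real.exp (2 * |ω| * T) * (4 * C ^ 2) * T * (l + m) := by
  have hbnd : ∀ s ∈ Set.Icc 0 T, |ω * s| ≤ |ω| * T := fun s hs => by
    rw [abs_mul, abs_of_nonneg hs.1]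
    gcongr
    exact hs.2
  have h1 := exp_mul_norm_sub_sq_le (ω := ω) (c := Real.exp (2 * |ω| * T) * (4 * C ^ 2 * (l + m)))
    (fun s hs => (hw s hs).1) (fun s hs => (hw' s hs).1) (fun s hs => by
      obtain ⟨-, hG, hz, ha⟩ := hw s hs
      obtain ⟨-, hG', hz', ha'⟩ := hw' s hs
      have hC : 0 ≤ C := (norm_nonneg _).trans ha
      have e1 : inner ℝ (w s - w' s) (-(a s) - ω • w s - (-(a' s) - ω • w' s))
          + ω * ‖w s - w' s‖ ^ 2 = -inner ℝ (w s - w' s) (a s - a' s) := by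
        rw [show -(a s) - ω • w s - (-(a' s) - ω • w' s)
          = -(a s - a' s) - ω • (w s - w' s) by module, inner_sub_right, inner_neg_right,
          inner_smul_right, real_inner_self_eq_norm_sq]
        ring
      -- Monotonicity applies to the resolvent points, not to the paths. The discrepancy between
      -- them is of order `l + m`.
      have e2 : inner ℝ (w s - w' s) (a s - a' s) = inner ℝ (z s - z' s) (a s - a' s)
          + inner ℝ (l • a s - m • a' s) (a s - a' s) := by
        rw [← inner_add_left, ← hz, ← hz']
        congr 1
        abel
      have e3 := hmono _ hG _ hG'
      have e4 : -(inner ℝ (l • a s - m • a' s) (a s - a' s)) ≤ (l * C + m * C) * (C + C) := by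
        refine (neg_le_abs _).trans ((abs_real_inner_le_norm _ _).trans ?_)
        gcongr
        · refine (norm_sub_le _ _).trans ?_
          rw [norm_smul, norm_smul, Real.norm_of_nonneg hl.le, Real.norm_of_nonneg hm.le]
          gcongr
        · exact (norm_sub_le _ _).trans (by gcongr)
      rw [e1, e2]
      refine (mul_le_mul_of_nonneg_left (show _ ≤ 4 * C ^ 2 * (l + m) from ?_)
        (Real.exp_pos _).le).trans ?_
      · simp only at e3
        nlinarith
      · have : 0 ≤ 4 * C ^ 2 * (l + m) := by positivity
        refine mul_le_mul_of_nonneg_right (Real.exp_le_exp.2 ?_) this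
        linarith [le_abs_self (ω * s), hbnd s hs]) ht
  rw [h0, sub_self, norm_zero, zero_pow two_ne_zero, zero_add] at h1
  have h2 : ‖w t - w' t‖ ^ 2 = Real.exp (-(2 * ω * t)) * (Real.exp (2 * ω * t) * ‖w t - w' t‖ ^ 2) := by
    rw [← mul_assoc, ← Real.exp_add, neg_add_cancel, Real.exp_zero, one_mul]
  rw [h2]
  calc _ ≤ Real.exp (2 * |ω| * T) * (Real.exp (2 * |ω| * T) * (4 * C ^ 2 * (l + m)) * T) := by
        refine mul_le_mul (Real.exp_le_exp.2 (by linarith [neg_abs_le (ω * t), hbnd t ht]))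
          (h1.trans ?_) (by positivity) (by positivity)
        gcongr
        exact ht.2
    _ = _ := by ring

end Evolution

/-! ### Passage to the limit and existence for the Cauchy problem. -/

section Minty

variable {H : Type*} [NormedAddCommGroup H] [InnerProductSpace ℝ H] {G : Set (H × H)}

/-- Monotone graphs with full resolvent are maximal monotone. -/
theorem mem_of_forall_inner_nonneg (hres : ∀ f : H, ∃ p ∈ G, p.1 + (1 : ℝ) • p.2 = f) {x h : H}
    (hx : ∀ p ∈ G, 0 ≤ inner ℝ (x - p.1) (h - p.2)) : (x, h) ∈ G := by
  obtain ⟨⟨z, k⟩, hG, hz⟩ := hres (x + h)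
  have h1 := hx _ hG
  simp only [one_smul] at hz h1
  have h2 : h - k = -(x - z) := by
    rw [neg_sub, sub_eq_sub_iff_add_eq_add, add_comm, ← hz]
  rw [h2, inner_neg_right, real_inner_self_eq_norm_sq] at h1
  have h3 : x - z = 0 := by
    rw [← norm_eq_zero]
    nlinarith [norm_nonneg (x - z)]
  rw [h3, neg_zero] at h2
  rwa [sub_eq_zero.1 h3, sub_eq_zero.1 h2]

/-- Existence for the Cauchy problem `v̇ + M v + ω v ∋ 0` with a maximal monotone graph `M` and an
initial value in its domain. -/
theorem exists_evolution [CompleteSpace H]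
    (hmono : ∀ p ∈ G, ∀ q ∈ G, 0 ≤ inner ℝ (p.1 - q.1) (p.2 - q.2))
    (hres : ∀ l : ℝ, 0 < l → ∀ f : H, ∃ p ∈ G, p.1 + l • p.2 = f)
    {x₀ h₀ : H} (h0 : (x₀, h₀) ∈ G) (ω : ℝ) {T : ℝ} (hT : 0 < T) :
    ∃ (v g : ℝ → H) (K : NNReal), v 0 = x₀ ∧ LipschitzOnWith K v (Set.Icc 0 T) ∧
      MemLp g 2 (volume.restrict (Set.Icc 0 T)) ∧
      ∀ᵐ t ∂(volume.restrict (Set.Icc 0 T)), HasDerivAt v (g t) t ∧ (v t, -(g t) - ω • v t) ∈ G := by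
  obtain ⟨C, R, hpath⟩ := exists_yosida_path hmono hres h0 ω hT
  have hl : ∀ n : ℕ, (0 : ℝ) < 1 / ((n : ℝ) + 1) := fun n => by positivity
  have hl0 : Tendsto (fun n : ℕ => 1 / ((n : ℝ) + 1)) atTop (𝓝 0) :=
    tendsto_one_div_add_atTop_nhds_zero_nat
  choose w z a hw0 hw using fun n : ℕ => hpath _ (hl n)
  have hT0 : (0 : ℝ) ∈ Set.Icc 0 T := ⟨le_rfl, hT.le⟩
  have hC : 0 ≤ C := (norm_nonneg _).trans (hw 0 0 hT0).2.2.2.2.1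
  have hR : 0 ≤ R := (norm_nonneg _).trans (hw 0 0 hT0).2.2.2.2.2
  set D : ℝ := Real.exp (2 * |ω| * T) * Real.exp (2 * |ω| * T) * (4 * C ^ 2) * T with hD
  have hD0 : 0 ≤ D := by positivity
  have hdist : ∀ n m, ∀ t ∈ Set.Icc 0 T, ‖w n t - w m t‖ ^ 2
      ≤ D * (1 / ((n : ℝ) + 1) + 1 / ((m : ℝ) + 1)) := fun n m t ht =>
    norm_sub_sq_le_of_yosida hmono (hl n) (hl m) ((hw0 n).trans (hw0 m).symm)
      (fun s hs => ⟨(hw n s hs).1, (hw n s hs).2.2.1, (hw n s hs).2.2.2.1, (hw n s hs).2.2.2.2.1⟩)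
      (fun s hs => ⟨(hw m s hs).1, (hw m s hs).2.2.1, (hw m s hs).2.2.2.1, (hw m s hs).2.2.2.2.1⟩) ht
  have hlim : ∀ t : ℝ, ∃ u : H, t ∈ Set.Icc 0 T → Tendsto (fun n => w n t) atTop (𝓝 u) := by
    intro t
    by_cases ht : t ∈ Set.Icc 0 T
    · have : CauchySeq fun n => w n t := by
        refine cauchySeq_of_le_tendsto_0' (fun n : ℕ => √(D * (1 / ((n : ℝ) + 1) + 1 / ((n : ℝ) + 1))))
          (fun n m hnm => ?_) ?_
        · rw [dist_eq_norm]
          refine Real.le_sqrt_of_sq_le ((hdist n m t ht).trans ?_)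
          gcongr
        · simpa using ((hl0.add hl0).const_mul D).sqrt
      obtain ⟨u, hu⟩ := cauchySeq_tendsto_of_complete this
      exact ⟨u, fun _ => hu⟩
    · exact ⟨0, fun h => absurd h ht⟩
  choose u hu using hlim
  -- A single rate for both approximations: the first term is the distance to `w n`, the second that
  -- from `w n` to the resolvent point `z n`.
  set η : ℕ → ℝ := fun n => √(D * (1 / ((n : ℝ) + 1))) + 1 / ((n : ℝ) + 1) * C with hη
  have hη0 : Tendsto η atTop (𝓝 0) := by
    simpa [hη] using ((hl0.const_mul D).sqrt).add (hl0.mul_const C)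
  have hηanti : ∀ {n m : ℕ}, n ≤ m → η m ≤ η n := fun {n m} h => by
    simp only [hη]
    gcongr
  have huw' : ∀ n, ∀ t ∈ Set.Icc 0 T, ‖u t - w n t‖ ≤ √(D * (1 / ((n : ℝ) + 1))) := by
    intro n t ht
    refine Real.le_sqrt_of_sq_le ?_
    have h1 := ((hu t ht).sub_const (w n t)).norm.pow 2
    have h2 : Tendsto (fun m : ℕ => D * (1 / ((m : ℝ) + 1) + 1 / ((n : ℝ) + 1))) atTop
        (𝓝 (D * (0 + 1 / ((n : ℝ) + 1)))) := (hl0.add_const _).const_mul D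
    rw [zero_add] at h2
    exact le_of_tendsto_of_tendsto' h1 h2 fun m => hdist m n t ht
  have huw : ∀ n, ∀ t ∈ Set.Icc 0 T, ‖u t - w n t‖ ≤ η n := fun n t ht =>
    (huw' n t ht).trans (le_add_of_nonneg_right (by positivity))
  have huz : ∀ n, ∀ t ∈ Set.Icc 0 T, ‖u t - z n t‖ ≤ η n := by
    intro n t ht
    obtain ⟨-, -, -, h1, h2, -⟩ := hw n t ht
    calc ‖u t - z n t‖ = ‖(u t - w n t) + (1 / ((n : ℝ) + 1)) • a n t‖ := by
          rw [← h1]; congr 1; module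
      _ ≤ ‖u t - w n t‖ + ‖(1 / ((n : ℝ) + 1)) • a n t‖ := norm_add_le _ _
      _ ≤ _ := by
        rw [norm_smul, Real.norm_of_nonneg (hl n).le]
        exact add_le_add (huw' n t ht) (mul_le_mul_of_nonneg_left h2 (hl n).le)
  set f : ℕ → ℝ → H := fun n t => -(a n t) - ω • w n t with hf
  set B : ℝ := C + |ω| * R with hB
  have hB0 : 0 ≤ B := by positivity
  have hfB : ∀ n, ∀ t ∈ Set.Icc 0 T, ‖f n t‖ ≤ B := by
    intro n t ht
    refine (norm_sub_le _ _).trans ?_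
    rw [norm_neg, norm_smul, Real.norm_eq_abs, hB]
    gcongr
    exacts [(hw n t ht).2.2.2.2.1, (hw n t ht).2.2.2.2.2]
  have hfc : ∀ n, ContinuousOn (f n) (Set.Icc 0 T) := fun n t ht =>
    (hw n t ht).2.1.neg.sub ((hw n t ht).1.continuousAt.continuousWithinAt.const_smul ω)
  set μ : Measure ℝ := volume.restrict (Set.Icc 0 T) with hμ
  have hfae : ∀ n, ∀ᵐ t ∂μ, ‖f n t‖ ≤ B := fun n =>
    (ae_restrict_mem measurableSet_Icc).mono (hfB n)
  have hfL : ∀ n, MemLp (f n) 2 μ := fun n =>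
    MemLp.of_bound ((hfc n).aestronglyMeasurable measurableSet_Icc) B (hfae n)
  have hnorm : ∀ n, ‖(hfL n).toLp (f n)‖ ≤ _ := fun n =>
    Lp.norm_le_of_ae_bound hB0 (by
      filter_upwards [(hfL n).coeFn_toLp, hfae n] with t h1 h2
      rwa [h1])
  obtain ⟨g, y, hy, hyg⟩ := exists_tendsto_convexHull_tail hnorm
  have hhull : ∀ (n : ℕ) (Q : Set (Lp H 2 μ)), Convex ℝ Q →
      (∀ k, n ≤ k → (hfL k).toLp (f k) ∈ Q) → y n ∈ Q := fun n Q hQ h =>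
    convexHull_min (by rintro _ ⟨k, hk, rfl⟩; exact h k hk) hQ (hy n)
  -- the limit derivative integrates to the limit path
  have hint : ∀ t ∈ Set.Icc 0 T, u t = x₀ + ∫ s in (0 : ℝ)..t, g s := by
    intro t ht
    have hsub : Set.Ioc 0 t ⊆ Set.Icc 0 T := fun s hs => ⟨hs.1.le, hs.2.trans ht.2⟩
    have hμt : μ (Set.Ioc 0 t) ≠ ⊤ := measure_ne_top _ _
    have hset : ∀ q : ℝ → H, ∫ s in Set.Ioc 0 t, q s ∂μ = ∫ s in (0 : ℝ)..t, q s := fun q => by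
      rw [hμ, Measure.restrict_restrict measurableSet_Ioc, Set.inter_eq_left.2 hsub,
        intervalIntegral.integral_of_le ht.1]
    have hwint : ∀ n, ∫ s in Set.Ioc 0 t, ((hfL n).toLp (f n) : ℝ → H) s ∂μ = w n t - x₀ := by
      intro n
      rw [integral_congr_ae (ae_restrict_of_ae (hfL n).coeFn_toLp), hset, ← hw0 n]
      refine intervalIntegral.integral_eq_sub_of_hasDerivAt (fun s hs => ?_) ?_
      · rw [Set.uIcc_of_le ht.1] at hs
        exact (hw n s ⟨hs.1, hs.2.trans ht.2⟩).1
      · refine ContinuousOn.intervalIntegrable ?_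
        rw [Set.uIcc_of_le ht.1]
        exact (hfc n).mono (Set.Icc_subset_Icc_right ht.2)
    have hinner : ∀ c : H, inner ℝ c (∫ s in (0 : ℝ)..t, g s) = inner ℝ c (u t - x₀) := by
      intro c
      rw [← hset, ← L2.inner_indicatorConstLp_eq_inner_setIntegral ℝ measurableSet_Ioc hμt]
      set I := indicatorConstLp 2 measurableSet_Ioc hμt c
      have h1 : ∀ n, |inner ℝ I (y n) - inner ℝ c (u t - x₀)| ≤ ‖c‖ * η n := by
        intro n
        refine hhull n {ξ | |inner ℝ I ξ - inner ℝ c (u t - x₀)| ≤ ‖c‖ * η n} ?_ ?_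
        · have : {ξ : Lp H 2 μ | |inner ℝ I ξ - inner ℝ c (u t - x₀)| ≤ ‖c‖ * η n}
              = (innerSL ℝ I) ⁻¹' Metric.closedBall (inner ℝ c (u t - x₀)) (‖c‖ * η n) := by
            ext ξ
            simp [Real.dist_eq]
          rw [this]
          exact (convex_closedBall _ _).linear_preimage (innerSL ℝ I).toLinearMap
        · intro k hk
          rw [Set.mem_ofPred_eq, L2.inner_indicatorConstLp_eq_inner_setIntegral ℝ measurableSet_Ioc hμt, hwint,
            ← inner_sub_right]
          refine (abs_real_inner_le_norm _ _).trans ?_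
          gcongr
          rw [sub_sub_sub_cancel_right, norm_sub_rev]
          exact (huw k t ht).trans (hηanti hk)
      have h2 : Tendsto (fun n => |inner ℝ I (y n) - inner ℝ c (u t - x₀)|) atTop
          (𝓝 |inner ℝ I g - inner ℝ c (u t - x₀)|) :=
        ((tendsto_const_nhds.inner hyg).sub_const _).abs
      have h3 := le_of_tendsto_of_tendsto' h2 (hη0.const_mul ‖c‖) h1
      rw [mul_zero] at h3
      exact sub_eq_zero.1 (abs_nonpos_iff.1 h3)
    rw [ext_inner_left ℝ hinner, add_sub_cancel]
  -- Minty's trick along a subsequence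
  have hminty : ∀ᵐ t ∂μ, (u t, -(g t) - ω • u t) ∈ G := by
    -- This approximate monotonicity inequality is affine in the velocity, so it passes to convex
    -- combinations. The null set must not depend on `p`, since `G` may be uncountable.
    have hQ : ∀ n, ∀ᵐ t ∂μ, ∀ p ∈ G, -(η n * (C + ‖p.2‖ + |ω| * ‖u t - p.1‖))
        ≤ inner ℝ (u t - p.1) (-(y n t) - ω • u t - p.2) := by
      intro n
      refine hhull n {ξ | ∀ᵐ t ∂μ, ∀ p ∈ G, -(η n * (C + ‖p.2‖ + |ω| * ‖u t - p.1‖))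
        ≤ inner ℝ (u t - p.1) (-(ξ t) - ω • u t - p.2)} ?_ ?_
      · intro ξ hξ ζ hζ k k' hk hk' hkk
        filter_upwards [hξ, hζ, Lp.coeFn_add (k • ξ) (k' • ζ), Lp.coeFn_smul k ξ,
          Lp.coeFn_smul k' ζ] with t h1 h2 h3 h4 h5 p hp
        rw [h3, Pi.add_apply, h4, h5, Pi.smul_apply, Pi.smul_apply]
        have e1 : -(k • ξ t + k' • ζ t) - ω • u t - p.2
            = k • (-(ξ t) - ω • u t - p.2) + k' • (-(ζ t) - ω • u t - p.2) := by
          have : k' = 1 - k := by linarith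
          subst this
          module
        rw [e1, inner_add_right, inner_smul_right, inner_smul_right]
        have e2 := mul_le_mul_of_nonneg_left (h1 p hp) hk
        have e3 := mul_le_mul_of_nonneg_left (h2 p hp) hk'
        have e4 : -(η n * (C + ‖p.2‖ + |ω| * ‖u t - p.1‖))
            = k * -(η n * (C + ‖p.2‖ + |ω| * ‖u t - p.1‖))
              + k' * -(η n * (C + ‖p.2‖ + |ω| * ‖u t - p.1‖)) := by
          rw [← add_mul, hkk, one_mul]
        rw [e4]
        exact add_le_add e2 e3
      · intro k hk
        filter_upwards [(hfL k).coeFn_toLp, ae_restrict_mem measurableSet_Icc] with t h1 ht p hp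
        rw [h1]
        obtain ⟨-, -, hG, -, ha, -⟩ := hw k t ht
        have e1 : inner ℝ (u t - p.1) (-(f k t) - ω • u t - p.2)
            = inner ℝ (z k t - p.1) (a k t - p.2) + inner ℝ (u t - z k t) (a k t - p.2)
              + inner ℝ (u t - p.1) (-(ω • (u t - w k t))) := by
          rw [← inner_add_left, show z k t - p.1 + (u t - z k t) = u t - p.1 by abel,
            ← inner_add_right]
          congr 1
          simp only [hf]
          module
        have e2 := hmono _ hG _ hp
        have e3 : -(η n * (C + ‖p.2‖)) ≤ inner ℝ (u t - z k t) (a k t - p.2) := by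
          refine neg_le_of_abs_le ((abs_real_inner_le_norm _ _).trans ?_)
          refine mul_le_mul ((huz k t ht).trans (hηanti hk)) ((norm_sub_le _ _).trans ?_)
            (norm_nonneg _) (by positivity)
          gcongr
        have e4 : -(η n * (|ω| * ‖u t - p.1‖)) ≤ inner ℝ (u t - p.1) (-(ω • (u t - w k t))) := by
          refine neg_le_of_abs_le ((abs_real_inner_le_norm _ _).trans ?_)
          rw [norm_neg, norm_smul, Real.norm_eq_abs]
          calc _ = ‖u t - w k t‖ * (|ω| * ‖u t - p.1‖) := by ring
            _ ≤ _ := by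
              gcongr
              exact (huw k t ht).trans (hηanti hk)
        rw [e1]
        simp only at e2
        linarith
    obtain ⟨ns, hns, hae⟩ := (tendstoInMeasure_of_tendsto_Lp hyg).exists_seq_tendsto_ae
    filter_upwards [hae, ae_all_iff.2 hQ] with t h1 h2
    refine mem_of_forall_inner_nonneg (hres 1 one_pos) fun p hp => ?_
    have h3 : Tendsto (fun i => inner ℝ (u t - p.1) (-(y (ns i) t) - ω • u t - p.2)) atTop
        (𝓝 (inner ℝ (u t - p.1) (-(g t) - ω • u t - p.2))) :=
      tendsto_const_nhds.inner ((h1.neg.sub_const _).sub_const _)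
    have h4 : Tendsto (fun i => -(η (ns i) * (C + ‖p.2‖ + |ω| * ‖u t - p.1‖))) atTop
        (𝓝 (-(0 * (C + ‖p.2‖ + |ω| * ‖u t - p.1‖)))) :=
      ((hη0.comp hns.tendsto_atTop).mul_const _).neg
    rw [zero_mul, neg_zero] at h4
    exact le_of_tendsto_of_tendsto' h4 h3 fun i => h2 (ns i) p hp
  have hg2 : MemLp g 2 μ := Lp.memLp g
  have hgI : IntervalIntegrable g volume 0 T := by
    rw [intervalIntegrable_iff_integrableOn_Icc_of_le hT.le]
    exact hg2.integrable (by norm_num)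
  -- The path `u` is unspecified outside `[0, T]`; the primitive of `g` agrees with it there and is
  -- defined on all of `ℝ`.
  refine ⟨fun t => x₀ + ∫ s in (0 : ℝ)..t, g s, g, Real.toNNReal B, by simp, ?_, hg2, ?_⟩
  · refine LipschitzOnWith.of_dist_le_mul fun s hs t ht => ?_
    rw [← hint s hs, ← hint t ht, Real.coe_toNNReal _ hB0]
    refine le_of_tendsto' ((hu s hs).dist (hu t ht)) fun n => ?_
    rw [dist_eq_norm, dist_eq_norm]
    exact (convex_Icc 0 T).norm_image_sub_le_of_norm_hasDerivWithin_le
      (fun r hr => (hw n r hr).1.hasDerivWithinAt) (hfB n) ht hs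
  · filter_upwards [hminty, ae_restrict_of_ae hgI.ae_hasDerivAt_integral,
      ae_restrict_mem measurableSet_Icc] with t h1 h2 ht
    rw [← hint t ht]
    rw [Set.uIcc_of_le hT.le] at h2
    exact ⟨(h2 ht 0 hT0).const_add x₀, h1⟩

end Minty

/-! ### Calculus in the path space. -/

section Paths

variable {H : Type*} [NormedAddCommGroup H]

theorem AbsolutelyContinuousOnInterval.norm {u : ℝ → H} {a b : ℝ}
    (hu : AbsolutelyContinuousOnInterval u a b) :
    AbsolutelyContinuousOnInterval (fun t => ‖u t‖) a b := by
  rw [absolutelyContinuousOnInterval_iff] at hu ⊢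
  intro ε hε
  obtain ⟨δ, hδ, h⟩ := hu ε hε
  refine ⟨δ, hδ, fun E hE hlt => lt_of_le_of_lt (Finset.sum_le_sum fun i _ => ?_) (h E hE hlt)⟩
  rw [Real.dist_eq, dist_eq_norm]
  exact abs_norm_sub_norm_le _ _

variable [InnerProductSpace ℝ H] {T : ℝ} {u : ℝ → H}

theorem ASD.MemA2.integrable_inner (hu : ASD.MemA2 T u) (hT : 0 ≤ T) :
    Integrable (fun t => inner ℝ (u t) (deriv u t)) (volume.restrict (Set.Icc 0 T)) := by
  obtain ⟨C, hC⟩ := hu.absCont.exists_bound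
  have hc := hu.absCont.continuousOn
  rw [Set.uIcc_of_le hT] at hC hc
  have h1 : Integrable (deriv u) (volume.restrict (Set.Icc 0 T)) :=
    hu.memLp_deriv.integrable (by norm_num)
  refine (h1.norm.const_mul C).mono'
    ((hc.aestronglyMeasurable measurableSet_Icc).inner hu.memLp_deriv.1) ?_
  filter_upwards [ae_restrict_mem measurableSet_Icc] with t ht
  refine (norm_inner_le_norm _ _).trans ?_
  gcongr
  exact hC t ht

/-- The scalar function `‖u‖²` is absolutely continuous as a product, so the real-valued fundamental
theorem of calculus suffices. -/
theorem ASD.MemA2.integral_inner (hu : ASD.MemA2 T u) (hT : 0 ≤ T) :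
    ∫ t in Set.Icc 0 T, inner ℝ (u t) (deriv u t) = (1 / 2) * ‖u T‖ ^ 2 - (1 / 2) * ‖u 0‖ ^ 2 := by
  have h1 := (hu.absCont.norm.mul hu.absCont.norm).integral_deriv_eq_sub
  rw [intervalIntegral.integral_of_le hT, ← integral_Icc_eq_integral_Ioc] at h1
  have h2 : ∫ t in Set.Icc 0 T, deriv ((fun t => ‖u t‖) * fun t => ‖u t‖) t
      = ∫ t in Set.Icc 0 T, 2 * inner ℝ (u t) (deriv u t) := by
    refine integral_congr_ae ?_
    filter_upwards [hu.ae_diff] with t ht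
    rw [show ((fun t => ‖u t‖) * fun t => ‖u t‖) = fun t => ‖u t‖ ^ 2 by
      ext s; simp [sq]]
    exact ht.hasDerivAt.norm_sq.deriv
  rw [h2, integral_const_mul] at h1
  simp only [Pi.mul_apply] at h1
  linarith

theorem memA2_of_lipschitzOnWith {v g : ℝ → H} {K : NNReal} (hT : 0 ≤ T)
    (hv : LipschitzOnWith K v (Set.Icc 0 T)) (hg : MemLp g 2 (volume.restrict (Set.Icc 0 T)))
    (hd : ∀ᵐ t ∂(volume.restrict (Set.Icc 0 T)), HasDerivAt v (g t) t) : ASD.MemA2 T v where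
  absCont := by
    refine LipschitzOnWith.absolutelyContinuousOnInterval (K := K) ?_
    rwa [Set.uIcc_of_le hT]
  ae_diff := hd.mono fun _ h => h.differentiableAt
  memLp_deriv := hg.ae_eq (hd.mono fun _ h => h.deriv.symm)

theorem hasDerivAt_exp_smul {v : ℝ → H} {v' : H} {t : ℝ} (ω : ℝ) (hv : HasDerivAt v v' t) :
    HasDerivAt (fun s => Real.exp (ω * s) • v s) (Real.exp (ω * t) • (v' + ω • v t)) t := by
  have h1 : HasDerivAt (fun s => Real.exp (ω * s)) (Real.exp (ω * t) * ω) t := by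
    simpa using ((hasDerivAt_id t).const_mul ω).exp
  refine (h1.smul hv).congr_deriv ?_
  module

theorem ASD.MemA2.exp_smul (hu : ASD.MemA2 T u) (hT : 0 ≤ T) (ω : ℝ) :
    ASD.MemA2 T fun t => Real.exp (ω * t) • u t where
  absCont := by
    have h1 : AbsolutelyContinuousOnInterval (fun t : ℝ => Real.exp (ω * t)) 0 T :=
      ContDiffOn.absolutelyContinuousOnInterval (by fun_prop)
    exact h1.smul hu.absCont
  ae_diff := hu.ae_diff.mono fun t h => (hasDerivAt_exp_smul ω h.hasDerivAt).differentiableAt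
  memLp_deriv := by
    obtain ⟨C, hC⟩ := hu.absCont.exists_bound
    have hc := hu.absCont.continuousOn
    rw [Set.uIcc_of_le hT] at hC hc
    have h1 : MemLp u 2 (volume.restrict (Set.Icc 0 T)) :=
      MemLp.of_bound (hc.aestronglyMeasurable measurableSet_Icc) C
        ((ae_restrict_mem measurableSet_Icc).mono hC)
    have h2 := hu.memLp_deriv.add (h1.const_smul ω)
    have h3 : MemLp (fun t => Real.exp (ω * t) • (deriv u t + ω • u t)) 2
        (volume.restrict (Set.Icc 0 T)) := by
      refine h2.of_le_mul (c := Real.exp (|ω| * T))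
        (AEStronglyMeasurable.smul (Continuous.aestronglyMeasurable (by fun_prop)) h2.1) ?_
      filter_upwards [ae_restrict_mem measurableSet_Icc] with t ht
      rw [norm_smul, Real.norm_of_nonneg (Real.exp_pos _).le]
      refine mul_le_mul_of_nonneg_right (Real.exp_le_exp.2 ?_) (norm_nonneg _)
      calc ω * t ≤ |ω| * t := mul_le_mul_of_nonneg_right (le_abs_self ω) ht.1
        _ ≤ |ω| * T := by gcongr; exact ht.2
    refine h3.ae_eq (hu.ae_diff.mono fun t h => ?_)
    exact (hasDerivAt_exp_smul ω h.hasDerivAt).deriv.symm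

end Paths

/-! ### Extended-real integrals. -/

section ERealIntegral

variable {α : Type*} [MeasurableSpace α] {μ : Measure α} {f : α → EReal} {g : α → ℝ}

theorem erealIntegral_coe (hg : Integrable g μ) :
    ASD.erealIntegral μ (fun a => (g a : EReal)) = ((∫ a, g a ∂μ : ℝ) : EReal) := by
  have h1 : ∫⁻ a, ENNReal.ofReal (g a) ∂μ ≠ ⊤ :=
    (hg.lintegral_lt_top).ne
  have h2 : ∫⁻ a, ENNReal.ofReal (-g a) ∂μ ≠ ⊤ := hg.neg.lintegral_lt_top.ne
  rw [integral_eq_lintegral_pos_part_sub_lintegral_neg_part hg, EReal.coe_sub,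
    EReal.coe_ennreal_toReal h1, EReal.coe_ennreal_toReal h2]
  simp only [ASD.erealIntegral, ← EReal.coe_neg, EReal.toENNReal_of_ne_top (EReal.coe_ne_top _),
    EReal.toReal_coe]

/-- No measurability is needed, as the lower Lebesgue integral is monotone on all functions. This
matters for the running cost, whose measurability is never established. -/
theorem erealIntegral_mono_ae {f' : α → EReal} (h : f ≤ᵐ[μ] f') :
    ASD.erealIntegral μ f ≤ ASD.erealIntegral μ f' := by
  refine EReal.sub_le_sub ?_ ?_
  · exact EReal.coe_ennreal_le_coe_ennreal_iff.2
      (lintegral_mono_ae (h.mono fun a ha => EReal.toENNReal_le_toENNReal ha))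
  · exact EReal.coe_ennreal_le_coe_ennreal_iff.2
      (lintegral_mono_ae (h.mono fun a ha =>
        EReal.toENNReal_le_toENNReal (EReal.neg_le_neg_iff.2 ha)))

end ERealIntegral

/-! ### Growth and conjugates of convex functions. -/

section Convex

variable {X : Type*} [NormedAddCommGroup X] {φ : X → ℝ}

theorem exists_abs_le_of_isBounded_image
    (h : ∀ B : Set X, Bornology.IsBounded B → Bornology.IsBounded (φ '' B)) (R : ℝ) :
    ∃ C : ℝ, ∀ x, ‖x‖ ≤ R → |φ x| ≤ C := by
  obtain ⟨C, hC⟩ := (h _ (Metric.isBounded_closedBall (x := (0 : X)) (r := R))).exists_norm_le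
  exact ⟨C, fun x hx => hC _ ⟨x, by simpa using hx, rfl⟩⟩

variable [NormedSpace ℝ X]

/-- On a large sphere of radius `R`, `φ` exceeds `φ 0` by at least one. Convexity along rays from
the origin propagates this as slope `1 / R`, and boundedness handles the inside of the ball. -/
theorem ConvexOn.exists_linear_growth (hφ : ConvexOn ℝ Set.univ φ)
    (hbdd : ∀ R : ℝ, ∃ C : ℝ, ∀ x, ‖x‖ ≤ R → |φ x| ≤ C)
    (hcoer : Tendsto φ (Bornology.cobounded X) atTop) :
    ∃ δ C : ℝ, 0 < δ ∧ ∀ z, δ * ‖z‖ - C ≤ φ z := by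
  have h1 := hcoer.eventually_ge_atTop (φ 0 + 1)
  rw [← comap_norm_atTop, eventually_comap, eventually_atTop] at h1
  obtain ⟨R₀, hR₀⟩ := h1
  set R : ℝ := max R₀ 1 with hR
  have hRpos : 0 < R := lt_of_lt_of_le one_pos (le_max_right _ _)
  obtain ⟨C, hC⟩ := hbdd R
  have hC0 := hC 0 (by simpa using hRpos.le)
  refine ⟨1 / R, C + 1, by positivity, fun z => ?_⟩
  rcases le_total ‖z‖ R with hz | hz
  · have h2 := neg_le_of_abs_le (hC z hz)
    have h3 : 1 / R * ‖z‖ ≤ 1 := by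
      rw [one_div, inv_mul_le_iff₀ hRpos]
      simpa using hz
    linarith
  · have hz0 : 0 < ‖z‖ := hRpos.trans_le hz
    have h2 := hφ.2 (Set.mem_univ z) (Set.mem_univ (0 : X))
      (show 0 ≤ R / ‖z‖ by positivity)
      (show 0 ≤ 1 - R / ‖z‖ by rw [sub_nonneg, div_le_one hz0]; exact hz) (by ring)
    have h3 : ‖(R / ‖z‖) • z‖ = R := by
      rw [norm_smul, Real.norm_of_nonneg (by positivity), div_mul_cancel₀ _ hz0.ne']
    have h4 := hR₀ R (le_max_left _ _) _ h3
    rw [smul_zero, add_zero, smul_eq_mul, smul_eq_mul] at h2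
    have h5 : 1 ≤ R / ‖z‖ * (φ z - φ 0) := by linarith
    have h6 : 1 / R * ‖z‖ ≤ φ z - φ 0 := by
      rw [div_mul_eq_mul_div, one_mul, div_le_iff₀ hRpos]
      rw [div_mul_eq_mul_div, le_div_iff₀ hz0] at h5
      linarith
    linarith [neg_le_of_abs_le hC0]

theorem conjugate_eq_of_mem_subdifferential {x : X} {p : StrongDual ℝ X}
    (hp : p ∈ ASD.subdifferential φ x) : ASD.conjugate φ p = ((p x - φ x : ℝ) : EReal) := by
  refine le_antisymm (iSup_le fun z => EReal.coe_le_coe_iff.2 ?_)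
    (le_iSup (fun z : X => ((p z - φ z : ℝ) : EReal)) x)
  have := hp z
  rw [map_sub] at this
  linarith

end Convex

/-! ### The boundary graph and the action functional. -/

section Application

variable {X H H₁ H₂ : Type*} [NormedAddCommGroup X] [NormedSpace ℝ X]
  [NormedAddCommGroup H] [InnerProductSpace ℝ H]
  [NormedAddCommGroup H₁] [InnerProductSpace ℝ H₁]
  [NormedAddCommGroup H₂] [InnerProductSpace ℝ H₂]
  {j : X →L[ℝ] H} {A : X →ₗ.[ℝ] StrongDual ℝ X} {b : X →ₗ.[ℝ] (H₁ × H₂)} {φ : X → ℝ}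

theorem toDualX_apply (j : X →L[ℝ] H) (h : H) (x : X) : ASD.toDualX j h x = inner ℝ h (j x) := rfl

theorem ASD.SkewAdjointModulo.apply_self (hA : ASD.SkewAdjointModulo A b) (x : X)
    (hxA : x ∈ A.domain) (hxb : x ∈ b.domain) :
    A ⟨x, hxA⟩ x = (1 / 2) * (‖(b ⟨x, hxb⟩).1‖ ^ 2 - ‖(b ⟨x, hxb⟩).2‖ ^ 2) := by
  have := hA.green x x hxA hxb hxA hxb
  rw [real_inner_self_eq_norm_sq, real_inner_self_eq_norm_sq] at this
  linarith

theorem ASD.SkewAdjointModulo.exists_mem_subdifferential (hA : ASD.SkewAdjointModulo A b)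
    (hX : ASD.IsReflexive X) {ψ : X → ℝ} (hψ : ConvexOn ℝ Set.univ ψ)
    (hbdd : ∀ R : ℝ, ∃ C : ℝ, ∀ x, ‖x‖ ≤ R → ψ x ≤ C)
    (hcoer : ∃ δ C : ℝ, 0 < δ ∧ ∀ z, δ * ‖z‖ - C ≤ ψ z) :
    ∃ (y : X) (hyA : y ∈ A.domain) (hyb : y ∈ b.domain),
      (b ⟨y, hyb⟩).1 = 0 ∧ A ⟨y, hyA⟩ ∈ ASD.subdifferential ψ y := by
  obtain ⟨⟨y, hyA, hyb⟩, h1, h2⟩ := exists_mem_subdifferential_of_skewAdjoint hX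
    (S := A.domain ⊓ b.domain)
    (A.toFun ∘ₗ Submodule.inclusion inf_le_left)
    (LinearMap.fst ℝ H₁ H₂ ∘ₗ b.toFun ∘ₗ Submodule.inclusion inf_le_right)
    (LinearMap.snd ℝ H₁ H₂ ∘ₗ b.toFun ∘ₗ Submodule.inclusion inf_le_right)
    (hA.dense_ker.mono (by
      rintro x ⟨hxA, hxb, hx⟩
      exact ⟨⟨x, hxA, hxb⟩, rfl, congrArg Prod.fst hx, congrArg Prod.snd hx⟩))
    (hA.dense_image.mono (by
      rintro h ⟨x, hxA, hxb, rfl⟩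
      exact ⟨⟨x, hxA, hxb⟩, rfl⟩))
    (fun y hy => (hA.mem_iff y).2 (hy.mono (by
      rintro _ ⟨x, hxA, hxb, hx, rfl⟩
      exact ⟨⟨x, hxA, hxb⟩, hx, rfl⟩)))
    (fun s t => hA.green s t s.2.1 s.2.2 t.2.1 t.2.2) hψ hbdd hcoer
  exact ⟨y, hyA, hyb, h1, h2⟩

/-- The graph in `H` of the operator `∂φ - A` with boundary condition `b₁ = 0`. -/
def boundaryGraph (j : X →L[ℝ] H) (A : X →ₗ.[ℝ] StrongDual ℝ X) (b : X →ₗ.[ℝ] (H₁ × H₂))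
    (φ : X → ℝ) : Set (H × H) :=
  {p | ∃ (x : X) (hA : x ∈ A.domain) (hb : x ∈ b.domain), j x = p.1 ∧ (b ⟨x, hb⟩).1 = 0 ∧
    ASD.toDualX j p.2 + A ⟨x, hA⟩ ∈ ASD.subdifferential φ x}

/-- Add the two subgradient inequalities. By the Green formula and `b₁ = 0`, the contribution of `A`
has the favourable sign `-‖b₂ (x - y)‖² / 2`. -/
theorem boundaryGraph_monotone (hA : ASD.SkewAdjointModulo A b) :
    ∀ p ∈ boundaryGraph j A b φ, ∀ q ∈ boundaryGraph j A b φ,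
      0 ≤ inner ℝ (p.1 - q.1) (p.2 - q.2) := by
  rintro ⟨_, h⟩ ⟨x, hxA, hxb, rfl, hx0, hx⟩ ⟨_, k⟩ ⟨y, hyA, hyb, rfl, hy0, hy⟩
  have h1 := hx y
  have h2 := hy x
  have h3 := hA.apply_self (x - y) (sub_mem hxA hyA) (sub_mem hxb hyb)
  have h4 : A ⟨x - y, sub_mem hxA hyA⟩ = A ⟨x, hxA⟩ - A ⟨y, hyA⟩ := A.map_sub ⟨x, hxA⟩ ⟨y, hyA⟩
  have h5 : b ⟨x - y, sub_mem hxb hyb⟩ = b ⟨x, hxb⟩ - b ⟨y, hyb⟩ := b.map_sub ⟨x, hxb⟩ ⟨y, hyb⟩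
  rw [h4, h5, Prod.fst_sub, hx0, hy0, sub_zero, norm_zero] at h3
  simp only [sub_apply, add_apply, map_sub, toDualX_apply] at h1 h2 h3
  simp only [← map_sub, inner_sub_right]
  rw [real_inner_comm _ (j (x - y)), real_inner_comm _ (j (x - y)), map_sub, inner_sub_right,
    inner_sub_right]
  nlinarith [sq_nonneg ‖(b ⟨x, hxb⟩ - b ⟨y, hyb⟩).2‖]

/-- The subdifferential of the sum of `φ` and a quadratic perturbation. -/
theorem add_toDualX_mem_subdifferential {l : ℝ} (hl : 0 < l) (hφ : ConvexOn ℝ Set.univ φ) {f : H}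
    {x : X} {p : StrongDual ℝ X}
    (hp : p ∈ ASD.subdifferential (fun z => φ z + 1 / (2 * l) * ‖j z - f‖ ^ 2) x) :
    ASD.toDualX j (l⁻¹ • (f - j x)) + p ∈ ASD.subdifferential φ x := by
  intro z
  set d : ℝ := φ z - φ x - p (z - x) - l⁻¹ * inner ℝ (f - j x) (j (z - x)) with hd
  -- Testing at `x + s (z - x)` and dividing by `s` leaves the quadratic remainder with a factor
  -- `s`, which vanishes in the limit.
  have hs : ∀ s : ℝ, 0 < s → s ≤ 1 → 0 ≤ d + s * (1 / (2 * l) * ‖j (z - x)‖ ^ 2) := by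
    intro s hs hs1
    have h1 := hp (x + s • (z - x))
    have h2 := hφ.2 (Set.mem_univ x) (Set.mem_univ z) (sub_nonneg.2 hs1) hs.le (by ring)
    rw [show (1 - s) • x + s • z = x + s • (z - x) by module, smul_eq_mul, smul_eq_mul] at h2
    have h3 : ‖j (x + s • (z - x)) - f‖ ^ 2
        = ‖j x - f‖ ^ 2 - 2 * s * inner ℝ (f - j x) (j (z - x)) + s ^ 2 * ‖j (z - x)‖ ^ 2 := by
      rw [show j (x + s • (z - x)) - f = (j x - f) + s • j (z - x) by
        rw [map_add, map_smul]; abel, norm_add_sq_real, norm_smul, inner_smul_right, mul_pow,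
        Real.norm_eq_abs, sq_abs, ← neg_sub f (j x), inner_neg_left]
      ring
    simp only [add_sub_cancel_left, map_smul, smul_eq_mul] at h1
    rw [h3] at h1
    have h4 : 1 / (2 * l) * (‖j x - f‖ ^ 2 - 2 * s * inner ℝ (f - j x) (j (z - x))
        + s ^ 2 * ‖j (z - x)‖ ^ 2) = 1 / (2 * l) * ‖j x - f‖ ^ 2
        - s * (l⁻¹ * inner ℝ (f - j x) (j (z - x)))
        + s * (s * (1 / (2 * l) * ‖j (z - x)‖ ^ 2)) := by
      field_simp
    rw [h4] at h1
    have h5 : 0 ≤ s * (d + s * (1 / (2 * l) * ‖j (z - x)‖ ^ 2)) := by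
      rw [hd]
      linarith
    exact nonneg_of_mul_nonneg_right h5 hs
  have hd0 : 0 ≤ d := by
    have h1 : Tendsto (fun s : ℝ => d + s * (1 / (2 * l) * ‖j (z - x)‖ ^ 2)) (𝓝[>] 0)
        (𝓝 (d + 0 * (1 / (2 * l) * ‖j (z - x)‖ ^ 2))) :=
      (Continuous.tendsto (by fun_prop) 0).mono_left nhdsWithin_le_nhds
    rw [zero_mul, add_zero] at h1
    refine ge_of_tendsto h1 ?_
    filter_upwards [Ioc_mem_nhdsGT one_pos] with s h using hs s h.1 h.2
  rw [add_apply, toDualX_apply, inner_smul_left]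
  simp only [conj_trivial]
  linarith

/-- The resolvent equation is the stationary inclusion for `φ + ‖j · - f‖² / (2l)`; moving the
derivative of the quadratic term to the other side gives the element `l⁻¹ (f - j y)` of the graph
over `j y`. -/
theorem boundaryGraph_resolvent (hA : ASD.SkewAdjointModulo A b) (hX : ASD.IsReflexive X)
    (hφ : ConvexOn ℝ Set.univ φ) (hbdd : ∀ R : ℝ, ∃ C : ℝ, ∀ x, ‖x‖ ≤ R → |φ x| ≤ C)
    (hcoer : ∃ δ C : ℝ, 0 < δ ∧ ∀ z, δ * ‖z‖ - C ≤ φ z) (l : ℝ) (hl : 0 < l) (f : H) :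
    ∃ p ∈ boundaryGraph j A b φ, p.1 + l • p.2 = f := by
  obtain ⟨y, hyA, hyb, hy0, hy⟩ := hA.exists_mem_subdifferential hX
    (ψ := fun z => φ z + 1 / (2 * l) * ‖j z - f‖ ^ 2)
    (by
      refine hφ.add ⟨convex_univ, fun x _ z _ a c ha hc hac => ?_⟩
      have h1 := norm_sq_convex_comb_le (j x - f) (j z - f) ha hc hac
      have h2 : a • (j x - f) + c • (j z - f) = j (a • x + c • z) - f := by
        rw [map_add, map_smul, map_smul]
        have : c = 1 - a := by linarith
        subst this
        module
      rw [h2] at h1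
      simp only [smul_eq_mul]
      have h3 := mul_le_mul_of_nonneg_left h1 (show 0 ≤ 1 / (2 * l) by positivity)
      linarith)
    (fun R => by
      obtain ⟨C, hC⟩ := hbdd R
      refine ⟨C + 1 / (2 * l) * (‖j‖ * R + ‖f‖) ^ 2, fun x hx => ?_⟩
      have h1 := (le_abs_self _).trans (hC x hx)
      have h2 : ‖j x - f‖ ≤ ‖j‖ * R + ‖f‖ := (norm_sub_le _ _).trans (by
        gcongr
        exact (j.le_opNorm x).trans (by gcongr))
      gcongr)
    (by
      obtain ⟨δ, C, hδ, hC⟩ := hcoer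
      refine ⟨δ, C, hδ, fun z => (hC z).trans ?_⟩
      have : 0 ≤ 1 / (2 * l) * ‖j z - f‖ ^ 2 := by positivity
      linarith)
  refine ⟨(j y, l⁻¹ • (f - j y)), ⟨y, hyA, hyb, rfl, hy0,
    add_toDualX_mem_subdifferential hl hφ hy⟩, ?_⟩
  simp [smul_smul, hl.ne']

/-- Fenchel's inequality bounds the bracket by a pairing in which the exponential weights cancel.
The Green formula and the boundary term then leave `‖b₁ x‖² ≥ 0`. -/
theorem le_runningCost (hA : ASD.SkewAdjointModulo A b) (ω t : ℝ) (h p : H) :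
    ((-inner ℝ h p : ℝ) : EReal) ≤ ASD.runningCost j A b φ ω t h p := by
  refine le_iInf fun x => le_iInf fun hxA => le_iInf fun hxb => le_iInf fun hx => ?_
  subst hx
  set q : StrongDual ℝ X := Real.exp (-(ω * t)) • (A ⟨x, hxA⟩ - ASD.toDualX j p) with hq
  set x' : X := Real.exp (-(ω * t)) • x with hx'
  have h1 : ((q x' - φ x' : ℝ) : EReal) ≤ ASD.conjugate φ q :=
    le_iSup (fun z : X => ((q z - φ z : ℝ) : EReal)) x'
  have h2 : Real.exp (2 * ω * t) * q x' = A ⟨x, hxA⟩ x - inner ℝ (j x) p := by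
    rw [hq, hx', smul_apply, map_smul, sub_apply, toDualX_apply, real_inner_comm, smul_eq_mul,
      smul_eq_mul, ← mul_assoc, ← mul_assoc, ← Real.exp_add, ← Real.exp_add,
      show 2 * ω * t + -(ω * t) + -(ω * t) = 0 by ring, Real.exp_zero, one_mul]
  have h3 : ((-inner ℝ (j x) p : ℝ) : EReal) ≤
      ((Real.exp (2 * ω * t) : ℝ) : EReal) * (((φ x' : ℝ) : EReal) + ((q x' - φ x' : ℝ) : EReal))
        + ((1 / 2 * ASD.bdrySq b ⟨x, hxb⟩ : ℝ) : EReal) := by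
    rw [← EReal.coe_add, ← EReal.coe_mul, ← EReal.coe_add, EReal.coe_le_coe_iff,
      add_sub_cancel, h2, hA.apply_self x hxA hxb, ASD.bdrySq]
    nlinarith [sq_nonneg ‖(b ⟨x, hxb⟩).1‖]
  have h4 : (0 : EReal) ≤ ((Real.exp (2 * ω * t) : ℝ) : EReal) :=
    EReal.coe_nonneg.2 (Real.exp_pos _).le
  refine h3.trans ?_
  gcongr

/-- Both losses in the lower bound vanish: a subgradient gives equality in Fenchel's inequality, and
`b₁ x = 0`. -/
theorem runningCost_le (hA : ASD.SkewAdjointModulo A b) {ω t : ℝ} {x : X} {p : H}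
    (hxA : x ∈ A.domain) (hxb : x ∈ b.domain) (hx0 : (b ⟨x, hxb⟩).1 = 0)
    (hx : Real.exp (-(ω * t)) • (A ⟨x, hxA⟩ - ASD.toDualX j p) ∈
      ASD.subdifferential φ (Real.exp (-(ω * t)) • x)) :
    ASD.runningCost j A b φ ω t (j x) p ≤ ((-inner ℝ (j x) p : ℝ) : EReal) := by
  refine iInf_le_of_le x (iInf_le_of_le hxA (iInf_le_of_le hxb (iInf_le_of_le rfl ?_)))
  rw [conjugate_eq_of_mem_subdifferential hx, ← EReal.coe_add, ← EReal.coe_mul, ← EReal.coe_add,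
    EReal.coe_le_coe_iff, add_sub_cancel, smul_apply, map_smul, sub_apply, toDualX_apply,
    real_inner_comm, smul_eq_mul, smul_eq_mul, ← mul_assoc, ← mul_assoc, ← Real.exp_add,
    ← Real.exp_add, show 2 * ω * t + -(ω * t) + -(ω * t) = 0 by ring, Real.exp_zero, one_mul,
    hA.apply_self x hxA hxb, ASD.bdrySq, hx0, norm_zero]
  linarith

theorem norm_sq_le_actionFunctional (hA : ASD.SkewAdjointModulo A b) (ω : ℝ) {T : ℝ} (hT : 0 ≤ T)
    {u : ℝ → H} (hu : ASD.MemA2 T u) :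
    ((‖u 0‖ ^ 2 : ℝ) : EReal) ≤ ASD.actionFunctional j A b φ ω T u := by
  have h1 : ((∫ t in Set.Icc 0 T, -inner ℝ (u t) (deriv u t) : ℝ) : EReal) ≤
      ASD.erealIntegral (volume.restrict (Set.Icc 0 T))
        fun t => ASD.runningCost j A b φ ω t (u t) (deriv u t) := by
    rw [← erealIntegral_coe (g := fun t => -inner ℝ (u t) (deriv u t))
      (hu.integrable_inner hT).neg]
    exact erealIntegral_mono_ae (Eventually.of_forall fun t => le_runningCost hA ω t _ _)
  rw [integral_neg, hu.integral_inner hT] at h1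
  calc ((‖u 0‖ ^ 2 : ℝ) : EReal) = ((-(1 / 2 * ‖u T‖ ^ 2 - 1 / 2 * ‖u 0‖ ^ 2) : ℝ) : EReal)
        + ((1 / 2 * ‖u 0‖ ^ 2 + 1 / 2 * ‖u T‖ ^ 2 : ℝ) : EReal) := by
        rw [← EReal.coe_add]
        congr 1
        ring
    _ ≤ _ := by
      unfold ASD.actionFunctional
      gcongr

theorem actionFunctional_le {ω T : ℝ} (hT : 0 ≤ T) {u : ℝ → H} (hu : ASD.MemA2 T u)
    (h : ∀ᵐ t ∂(volume.restrict (Set.Icc 0 T)),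
      ASD.runningCost j A b φ ω t (u t) (deriv u t) ≤ ((-inner ℝ (u t) (deriv u t) : ℝ) : EReal)) :
    ASD.actionFunctional j A b φ ω T u ≤ ((‖u 0‖ ^ 2 : ℝ) : EReal) := by
  have h1 : ASD.erealIntegral (volume.restrict (Set.Icc 0 T))
        (fun t => ASD.runningCost j A b φ ω t (u t) (deriv u t)) ≤
      ((∫ t in Set.Icc 0 T, -inner ℝ (u t) (deriv u t) : ℝ) : EReal) := by
    rw [← erealIntegral_coe (g := fun t => -inner ℝ (u t) (deriv u t))
      (hu.integrable_inner hT).neg]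
    exact erealIntegral_mono_ae h
  rw [integral_neg, hu.integral_inner hT] at h1
  calc _ ≤ ((-(1 / 2 * ‖u T‖ ^ 2 - 1 / 2 * ‖u 0‖ ^ 2) : ℝ) : EReal)
        + ((1 / 2 * ‖u 0‖ ^ 2 + 1 / 2 * ‖u T‖ ^ 2 : ℝ) : EReal) := by
        unfold ASD.actionFunctional
        gcongr
    _ = _ := by
      rw [← EReal.coe_add]
      congr 1
      ring

end Application

theorem proposition5p2
    {X H H₁ H₂ : Type*}
    [NormedAddCommGroup X] [NormedSpace ℝ X] [CompleteSpace X]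
    [NormedAddCommGroup H] [InnerProductSpace ℝ H] [CompleteSpace H]
    [NormedAddCommGroup H₁] [InnerProductSpace ℝ H₁] [CompleteSpace H₁]
    [NormedAddCommGroup H₂] [InnerProductSpace ℝ H₂] [CompleteSpace H₂]
    (j : X →L[ℝ] H) (hj : ASD.IsEvolutionTriple j)
    (A : X →ₗ.[ℝ] StrongDual ℝ X) (b : X →ₗ.[ℝ] (H₁ × H₂))
    (hA : ASD.SkewAdjointModulo A b)
    (φ : X → ℝ)
    (hφ_convex : ConvexOn ℝ Set.univ φ)
    (hφ_lsc : LowerSemicontinuous φ)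
    (hφ_bdd : ∀ B : Set X, Bornology.IsBounded B → Bornology.IsBounded (φ '' B))
    (hφ_coercive : Tendsto φ (Bornology.cobounded X) atTop)
    (hφ_unif : ∃ ε : ℝ, 0 < ε ∧ ConvexOn ℝ Set.univ (fun x => φ x - ε / 2 * ‖j x‖ ^ 2))
    (hφ_zero : ∃ h : H, ASD.toDualX j h ∈ ASD.subdifferential φ 0)
    (ω T : ℝ) (hT : 0 < T) :
    (∃ v : ℝ → H, ASD.IsSolution j A b φ ω T v) ∧
    (⨅ (u : ℝ → H) (_ : ASD.MemA2 T u), ASD.actionFunctional j A b φ ω T u) = 0 ∧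
    ∃ y : ℝ → H, ASD.MemA2 T y ∧ ASD.actionFunctional j A b φ ω T y = 0 ∧
      ASD.IsSolution j A b φ ω T (fun t => Real.exp (-(ω * t)) • y t) := by
  have hbdd := exists_abs_le_of_isBounded_image hφ_bdd
  obtain ⟨h, hh⟩ := hφ_zero
  -- The subgradient of `φ` at zero lying in `H` places the initial value in the domain of the
  -- graph.
  have h0 : ((0 : H), h) ∈ boundaryGraph j A b φ := by
    refine ⟨0, A.domain.zero_mem, b.domain.zero_mem, map_zero j, ?_, ?_⟩
    · rw [show b ⟨0, b.domain.zero_mem⟩ = 0 from b.map_zero, Prod.fst_zero]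
    · rwa [show A ⟨0, A.domain.zero_mem⟩ = 0 from A.map_zero, add_zero]
  obtain ⟨v, g, K, hv0, hvK, hg, hv⟩ := exists_evolution (boundaryGraph_monotone hA)
    (boundaryGraph_resolvent hA hj.reflexive hφ_convex hbdd
      (hφ_convex.exists_linear_growth hbdd hφ_coercive)) h0 ω hT
  have hvA : ASD.MemA2 T v := memA2_of_lipschitzOnWith hT.le hvK hg (hv.mono fun _ h => h.1)
  have hsol : ASD.IsSolution j A b φ ω T v := by
    refine ⟨hvA, hv.mono ?_, hv0⟩
    rintro t ⟨hd, x, hxA, hxb, hjx, hx0, hx⟩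
    refine ⟨x, hxA, hxb, hjx, ?_, hx0⟩
    convert hx using 1
    ext z
    simp only [hd.deriv, toDualX_apply, add_apply, sub_apply, neg_apply, smul_apply, inner_sub_left,
      inner_neg_left, inner_smul_left, conj_trivial, smul_eq_mul]
    ring
  have hyA := hvA.exp_smul hT.le ω
  have hy0 : ASD.actionFunctional j A b φ ω T (fun t => Real.exp (ω * t) • v t) = 0 := by
    refine le_antisymm ?_ ?_
    · refine (actionFunctional_le hT.le hyA ?_).trans_eq (by simp [hv0])
      filter_upwards [hvA.ae_diff, hsol.equation] with t hd ⟨x, hxA, hxb, hjx, hx, hx0⟩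
      have hA' : A ⟨Real.exp (ω * t) • x, A.domain.smul_mem _ hxA⟩ = Real.exp (ω * t) • A ⟨x, hxA⟩ :=
        A.map_smul (Real.exp (ω * t)) ⟨x, hxA⟩
      have hb' : b ⟨Real.exp (ω * t) • x, b.domain.smul_mem _ hxb⟩ = Real.exp (ω * t) • b ⟨x, hxb⟩ :=
        b.map_smul (Real.exp (ω * t)) ⟨x, hxb⟩
      have he : Real.exp (-(ω * t)) * Real.exp (ω * t) = 1 := by
        rw [← Real.exp_add, neg_add_cancel, Real.exp_zero]
      -- The derivative of `e^{ωt} v` contains `ω v`, so `e^{-ωt} (A y - ẏ)` is exactly `A v - v̇ -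
      -- ω v`, the subgradient in the equation.
      rw [(hasDerivAt_exp_smul ω hd.hasDerivAt).deriv, ← hjx, ← map_smul]
      refine runningCost_le hA (A.domain.smul_mem _ hxA) (b.domain.smul_mem _ hxb) ?_ ?_
      · rw [hb', Prod.smul_fst, hx0, smul_zero]
      · rw [hA', smul_smul _ _ x, he, one_smul]
        convert hx using 1
        ext z
        simp only [← hjx, toDualX_apply, sub_apply, add_apply, neg_apply, smul_apply,
          inner_add_left, inner_smul_left, conj_trivial, smul_eq_mul]
        rw [← mul_sub, ← mul_assoc, he]
        ring
    · exact (EReal.coe_nonneg.2 (sq_nonneg _)).trans (norm_sq_le_actionFunctional hA ω hT.le hyA)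
  refine ⟨⟨v, hsol⟩, ?_, _, hyA, hy0, ?_⟩
  · refine le_antisymm ((iInf₂_le _ hyA).trans_eq hy0) (le_iInf₂ fun u hu => ?_)
    exact (EReal.coe_nonneg.2 (sq_nonneg _)).trans (norm_sq_le_actionFunctional hA ω hT.le hu)
  · convert hsol using 2 with t
    rw [smul_smul, ← Real.exp_add, neg_add_cancel, Real.exp_zero, one_smul]
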